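/- Let $\omega=e^{i\pi/4}$, let $n\ge 1$, and let $V$ be a unitary $2^n\times 2^n$ matrix all of whose entries lie in the cyclotomic field $\mathbb{Q}(\omega)$. Then $V$ can be implemented exactly, over the Clifford+$T$ gate set, by a repeat-until-success (RUS) circuit with $n$ target qubits and $m\le 2$ ancilla qubits. Here a Clifford+$T$ circuit on a set of qubits is a finite sequence of gates $H=\frac{1}{\sqrt2}\begin{pmatrix}1&1\\1&-1\end{pmatrix}$, $T=\begin{pmatrix}1&0\\0&\omega\end{pmatrix}$ and CNOT acting on qubits of that set. An RUS circuit with $n$ target and $m$ ancilla qubits consists of a Clifford+$T$ circuit on the $n+m$ qubits, performing a unitary $U$; a measurement outcome $s\in\{0,1\}^m$ labelled "success", all other outcomes being "failures"; and, for each failure outcome $x$, a Clifford+$T$ correction circuit on the $n$ target qubits, performing a unitary $C_x$. In each round the ancillas are prepared in $|0\rangle^{\otimes m}$, $U$ is applied, and all ancillas are measured in the computational basis; on success the protocol stops, and on failure $x$ the circuit for $C_x$ is applied and the round is repeated. For an outcome $x$ let $K_x=(I\otimes\langle x|)\,U\,(I\otimes|0^m\rangle)$ be the operator that the round performs on the target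 qubits. The RUS circuit implements $V$ exactly if 1. $K_s=\sqrt p\,V$ for some $p>0$ (the success probability of one round, independent of the input); and 2. for every $x\ne s$ there are $q_x\ge 0$, a unitary $W_x$ and a complex number $c_x$ of modulus one with $K_x=\sqrt{q_x}\,W_x$ and $C_x=c_x W_x^{-1}$ (so that every failure is undone, up to a global phase). -/

import Mathlib

/-- The primitive eighth root of unity `ω = exp (iπ/4)`. -/
noncomputable def omega8 : ℂ := Complex.exp (Complex.I * Real.pi / 4)

/-- Computational basis labels of a register whose qubits are labelled by `Q`. -/
abbrev Bits (Q : Type) : Type := Q → Fin 2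

/-- Operators on the register `Q`, written in the computational basis. -/
abbrev QOp (Q : Type) : Type := Matrix (Bits Q) (Bits Q) ℂ

/-- The Hadamard gate. -/
noncomputable def hadamard : Matrix (Fin 2) (Fin 2) ℂ :=
  ((1 / Real.sqrt 2 : ℝ) : ℂ) • !![1, 1; 1, -1]

/-- The `T` gate, `diag (1, ω)`. -/
noncomputable def tGate : Matrix (Fin 2) (Fin 2) ℂ := !![1, 0; 0, omega8]

section Circuits

variable {Q : Type} [Fintype Q] [DecidableEq Q]

/-- The single-qubit operator `A` acting on the qubit `q`, the other qubits being left alone. -/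
noncomputable def onQubit (A : Matrix (Fin 2) (Fin 2) ℂ) (q : Q) : QOp Q :=
  fun a b => if ∀ r, r ≠ q → a r = b r then A (a q) (b q) else 0

/-- `CNOT` with control `c` and target `t`: the basis state `b` is sent to the one in which
`b t` is replaced by `b t + b c` (mod 2). -/
noncomputable def cnotOp (c t : Q) : QOp Q :=
  fun a b => if a = Function.update b t (b t + b c) then 1 else 0

/-- The generating gates of Clifford+T. The remaining Clifford gates are products of these
(`S = T²`, `Z = T⁴`, `X = H Z H`). -/
inductive Gate (Q : Type) : Type
  | H (q : Q) : Gate Q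
  | T (q : Q) : Gate Q
  | CNOT (c t : Q) (h : c ≠ t) : Gate Q

/-- The operator performed by a gate. -/
noncomputable def Gate.op : Gate Q → QOp Q
  | .H q => onQubit hadamard q
  | .T q => onQubit tGate q
  | .CNOT c t _ => cnotOp c t

/-- A Clifford+T circuit on the register `Q` (no qubits outside `Q` are available): a list of
gates, the head of the list being performed first. -/
abbrev Circuit (Q : Type) : Type := List (Gate Q)

/-- The unitary operator performed by a circuit. -/
noncomputable def Circuit.op : Circuit Q → QOp Q
  | [] => 1
  | g :: gs => Circuit.op gs * g.op

end Circuits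

/-- A repeat-until-success circuit with `n` target qubits and `m` ancilla qubits. One round prepares
all ancillas in state `|0⟩`, performs `design` on targets and ancillas, and measures
all ancillas in the computational basis. If the outcome is `success`, the protocol stops; upon any
other outcome `x` the circuit `correction x` is performed on the target qubits, and the round is
repeated. -/
structure RUSCircuit (n m : ℕ) where
  design : Circuit (Fin n ⊕ Fin m)
  success : Bits (Fin m)
  correction : Bits (Fin m) → Circuit (Fin n)

/-- The operator `(1 ⊗ ⟨x|) U (1 ⊗ |0⟩)` performed on the target qubits by one round, before any
correction, when the measurement outcome is `x`. For a unit input vector `ψ`, the outcome `x` has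
probability `‖K ψ‖²`, and the target qubits are left in the state `K ψ / ‖K ψ‖`. -/
noncomputable def RUSCircuit.outcomeOp {n m : ℕ} (R : RUSCircuit n m) (x : Bits (Fin m)) :
    QOp (Fin n) :=
  fun a b => Circuit.op R.design (Sum.elim a x) (Sum.elim b (fun _ => 0))

/-- `R` implements `V` exactly: the measurement yields "success" with some probability `p > 0`, and
then the operator applied to the target qubits is `V`; upon every "failure" outcome `x` some unitary
`W` has been applied to the target qubits (the outcome having some probability `q ≥ 0`), and the
circuit `correction x` performs `W⁻¹` up to a global phase `c`, so that it restores the input. As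
`p > 0` does not depend on the input, the protocol stops with probability one. -/
def RUSCircuit.Implements {n m : ℕ} (R : RUSCircuit n m) (V : QOp (Fin n)) : Prop :=
  (∃ p : ℝ, 0 < p ∧ R.outcomeOp R.success = (Real.sqrt p : ℂ) • V) ∧
  ∀ x, x ≠ R.success →
    ∃ (q : ℝ) (W : QOp (Fin n)) (c : ℂ), 0 ≤ q ∧ W ∈ Matrix.unitaryGroup (Bits (Fin n)) ℂ ∧
      ‖c‖ = 1 ∧ R.outcomeOp x = (Real.sqrt q : ℂ) • W ∧
      Circuit.op (R.correction x) = c • W⁻¹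

/-!
The matrix `V` has a common denominator: `d V` is a matrix over `ℤ[ω]` for some positive integer
`d`. By Lagrange's theorem `4 ^ d - d ^ 2 = a² + b² + c² + e²`, so the four blocks
`d V`, `(a + b i) 1`, `(c + e i) 1`, `0`, all divided by `2 ^ d`, form an isometry `K` over
`ℤ[ω, 1/2]` with `2 ^ n` columns and `2 ^ (n + 2)` rows. If `K` is the part of a Clifford+T
operator in which the two ancillas start in `|0⟩`, the outcome `00` performs a multiple of `V` and
all other outcomes perform scalars, so every failure is undone by the empty circuit.

It remains to synthesize `K` on `n + 2 ≥ 3` qubits with no further ancilla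
(`exists_circuit_of_isometry`), which has two parts.

*Arithmetic.* `K` is reduced to a partial identity, column by column, by two-level Hadamard gates
`(i / √2) [[1, ω⁻ᵐ], [ωᵐ, -1]]` (`exists_mul_eq_partial_one`). Let `λ = 1 - ω`, so that `√2` is
`λ²` up to a unit. When a unit vector over `ℤ[ω, 1/2]` is written as `w / λ ^ k` with `k > 0`, the
number of entries of `w` prime to `λ` is even (`even_card_odd`). Such entries are powers of `ω`
modulo `λ³` (`exists_omega8_pow_add`), hence a suitable two-level Hadamard gate makes both entries
of a pair divisible by `λ` (`exists_hadamard_reduction`). Once `k = 0` the vector is a power of `ω`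
times a basis vector, and the power of `ω` is removed with the help of one further row. There is
always such a row because `K` has more rows than columns, and this is why operators of determinant
one suffice.

*Circuits.* The determinant of these two-level operators is one, and on at least three qubits they
are performed by circuits without ancillas (`twoLevel_mem_circuitOps`). Commutators of multiply
controlled gates give all multiply controlled `Z` gates that leave a qubit idle
(`controlSign_mem`); one more commutator, with a controlled `S` gate, gives the phases `i`, `-i` on
the two ends of an edge of the hypercube of basis states (`edge_phase_mem`). Conjugation by
single-qubit gates turns these into two-level Hadamard gates on edges, and rotations along paths in
the hypercube carry those to any two basis states.
-/

open Matrix hiding hadamard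

/-! ### The eighth root of unity -/

lemma omega8_eq :
    omega8 = ((Real.sqrt 2 / 2 : ℝ) : ℂ) + ((Real.sqrt 2 / 2 : ℝ) : ℂ) * Complex.I := by
  have h : Complex.I * Real.pi / 4 = ((Real.pi / 4 : ℝ) : ℂ) * Complex.I := by push_cast; ring
  rw [omega8, h, Complex.exp_mul_I, ← Complex.ofReal_cos, ← Complex.ofReal_sin,
    Real.cos_pi_div_four, Real.sin_pi_div_four]

lemma sqrt_two_sq : ((Real.sqrt 2 : ℝ) : ℂ) ^ 2 = 2 := by
  rw [← Complex.ofReal_pow, Real.sq_sqrt (by norm_num)]; norm_num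

lemma sqrt_two_ne_zero : ((Real.sqrt 2 : ℝ) : ℂ) ≠ 0 := by
  intro h; have := sqrt_two_sq; rw [h] at this; norm_num at this

lemma omega8_sq : omega8 ^ 2 = Complex.I := by
  rw [omega8_eq]; push_cast
  linear_combination ((1 + Complex.I) ^ 2 / 4) * sqrt_two_sq + (1 / 2) * Complex.I_sq

lemma omega8_pow_four : omega8 ^ 4 = -1 := by
  linear_combination (omega8 ^ 2 + Complex.I) * omega8_sq + Complex.I_sq

lemma omega8_pow_eight : omega8 ^ 8 = 1 := by
  linear_combination (omega8 ^ 4 - 1) * omega8_pow_four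

lemma omega8_ne_zero : omega8 ≠ 0 := Complex.exp_ne_zero _

lemma omega8_inv : omega8⁻¹ = -omega8 ^ 3 := by
  apply inv_eq_of_mul_eq_one_right
  linear_combination -omega8_pow_four

lemma norm_omega8 : ‖omega8‖ = 1 := by
  have h : Complex.I * Real.pi / 4 = ((Real.pi / 4 : ℝ) : ℂ) * Complex.I := by push_cast; ring
  rw [omega8, h, Complex.norm_exp_ofReal_mul_I]

lemma star_omega8 : star omega8 = omega8⁻¹ := by
  rw [Complex.inv_eq_conj norm_omega8]; rfl

lemma star_omega8_pow (m : ℕ) : star (omega8 ^ m) = (omega8 ^ m)⁻¹ := by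
  rw [star_pow, star_omega8, inv_pow]

lemma sqrt_two_eq_omega8 : ((Real.sqrt 2 : ℝ) : ℂ) = omega8 - omega8 ^ 3 := by
  rw [pow_succ, omega8_sq, omega8_eq]; push_cast
  linear_combination ((Real.sqrt 2 : ℝ) : ℂ) / 2 * Complex.I_sq

/-! ### The ring `ℤ[ω]` and its prime above two -/

/-- The ring `ℤ[ω]`, as the set of integer combinations of `1, ω, ω², ω³`. -/
def cycInt : Subring ℂ where
  carrier := {x | ∃ a b c d : ℤ, x = a + b * omega8 + c * omega8 ^ 2 + d * omega8 ^ 3}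
  mul_mem' := by
    rintro _ _ ⟨a, b, c, d, rfl⟩ ⟨a', b', c', d', rfl⟩
    refine ⟨a * a' - b * d' - c * c' - d * b', a * b' + b * a' - c * d' - d * c',
      a * c' + b * b' + c * a' - d * d', a * d' + b * c' + c * b' + d * a', ?_⟩
    push_cast
    linear_combination (b * d' + c * c' + d * b' + (c * d' + d * c') * omega8 +
      d * d' * omega8 ^ 2 : ℂ) * omega8_pow_four
  one_mem' := ⟨1, 0, 0, 0, by simp⟩
  add_mem' := by
    rintro _ _ ⟨a, b, c, d, rfl⟩ ⟨a', b', c', d', rfl⟩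
    exact ⟨a + a', b + b', c + c', d + d', by push_cast; ring⟩
  zero_mem' := ⟨0, 0, 0, 0, by simp⟩
  neg_mem' := by
    rintro _ ⟨a, b, c, d, rfl⟩
    exact ⟨-a, -b, -c, -d, by push_cast; ring⟩

lemma omega8_mem_cycInt : omega8 ∈ cycInt := ⟨0, 1, 0, 0, by simp⟩

lemma I_mem_cycInt : Complex.I ∈ cycInt := omega8_sq ▸ pow_mem omega8_mem_cycInt 2

lemma sqrt_two_mem_cycInt : ((Real.sqrt 2 : ℝ) : ℂ) ∈ cycInt := by
  rw [sqrt_two_eq_omega8]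
  exact sub_mem omega8_mem_cycInt (pow_mem omega8_mem_cycInt 3)

lemma omega8_pow_inv_mem_cycInt (m : ℕ) : (omega8 ^ m)⁻¹ ∈ cycInt := by
  rw [← inv_pow, omega8_inv]
  exact pow_mem (neg_mem (pow_mem omega8_mem_cycInt 3)) m

/-- The prime `1 - ω` of `ℤ[ω]` above `2`. -/
noncomputable def cycPrime : ℂ := 1 - omega8

lemma cycPrime_mem_cycInt : cycPrime ∈ cycInt := sub_mem (one_mem _) omega8_mem_cycInt

lemma cycPrime_ne_zero : cycPrime ≠ 0 := by
  intro h
  have h4 := omega8_pow_four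
  rw [← sub_eq_zero.mp h] at h4
  norm_num at h4

/-- `(1 - ω)²` is `√2` up to a unit. -/
lemma cycPrime_sq : cycPrime ^ 2 = (Real.sqrt 2 : ℂ) * (omega8 * (1 - (Real.sqrt 2 : ℂ))) := by
  rw [mul_sub, mul_one, mul_sub]
  have : (Real.sqrt 2 : ℂ) * (omega8 * (Real.sqrt 2 : ℂ)) = 2 * omega8 := by
    linear_combination omega8 * sqrt_two_sq
  rw [this, sqrt_two_eq_omega8, cycPrime]
  linear_combination omega8_pow_four

lemma two_eq_cycPrime : (2 : ℂ) = cycPrime ^ 3 *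
    (cycPrime * (-omega8 ^ 2 * (1 + (Real.sqrt 2 : ℂ)) ^ 2)) := by
  have h : cycPrime ^ 3 * (cycPrime * (-omega8 ^ 2 * (1 + (Real.sqrt 2 : ℂ)) ^ 2)) =
      (cycPrime ^ 2) ^ 2 * (-omega8 ^ 2 * (1 + (Real.sqrt 2 : ℂ)) ^ 2) := by ring
  rw [h, cycPrime_sq]
  have h' : ((Real.sqrt 2 : ℂ) * (omega8 * (1 - (Real.sqrt 2 : ℂ)))) ^ 2 *
      (-omega8 ^ 2 * (1 + (Real.sqrt 2 : ℂ)) ^ 2) =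
      -omega8 ^ 4 * ((Real.sqrt 2 : ℂ) ^ 2 * (1 - (Real.sqrt 2 : ℂ) ^ 2) ^ 2) := by ring
  rw [h', sqrt_two_sq, omega8_pow_four]
  norm_num

/-- Reduction modulo `1 - ω` is the parity of the sum of the coefficients. -/
lemma exists_cycPrime_mul_of_even {a b c d : ℤ} {x : ℂ}
    (hx : x = a + b * omega8 + c * omega8 ^ 2 + d * omega8 ^ 3) (h : Even (a + b + c + d)) :
    ∃ y ∈ cycInt, x = cycPrime * y := by
  obtain ⟨e, he⟩ := h
  have hd : (a : ℂ) = e + e - b - c - d := by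
    have : a = e + e - b - c - d := by omega
    rw [this]; push_cast; ring
  refine ⟨e * (cycPrime ^ 3 * (-omega8 ^ 2 * (1 + (Real.sqrt 2 : ℂ)) ^ 2)) - b -
    c * (1 + omega8) - d * (1 + omega8 + omega8 ^ 2), ?_, ?_⟩
  · have hc := cycPrime_mem_cycInt
    have ho := omega8_mem_cycInt
    have hs := sqrt_two_mem_cycInt
    have hz : ∀ z : ℤ, (z : ℂ) ∈ cycInt := fun z => intCast_mem _ z
    have h1 := one_mem cycInt
    exact sub_mem (sub_mem (sub_mem (mul_mem (hz e) (mul_mem (pow_mem hc 3)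
      (mul_mem (neg_mem (pow_mem ho 2)) (pow_mem (add_mem h1 hs) 2)))) (hz b))
      (mul_mem (hz c) (add_mem h1 ho))) (mul_mem (hz d) (add_mem (add_mem h1 ho) (pow_mem ho 2)))
  · rw [hx, hd]
    have h2 := two_eq_cycPrime
    have hl : cycPrime = 1 - omega8 := rfl
    linear_combination (e : ℂ) * h2 + (b + c * (1 + omega8) + d * (1 + omega8 + omega8 ^ 2)) * hl

lemma cycInt_sub_one {x : ℂ} (hx : x ∈ cycInt) (hodd : ∀ y ∈ cycInt, x ≠ cycPrime * y) :
    ∃ y ∈ cycInt, x = 1 + cycPrime * y := by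
  obtain ⟨a, b, c, d, hx⟩ := hx
  have hno : ¬ Even (a + b + c + d) := fun h => by
    obtain ⟨y, hy, hxy⟩ := exists_cycPrime_mul_of_even hx h
    exact hodd y hy hxy
  have hx' : x - 1 = ((a - 1 : ℤ) : ℂ) + b * omega8 + c * omega8 ^ 2 + d * omega8 ^ 3 := by
    rw [hx]; push_cast; ring
  obtain ⟨y, hy, h⟩ := exists_cycPrime_mul_of_even hx' (by
    rw [Int.not_even_iff_odd] at hno
    obtain ⟨k, hk⟩ := hno
    exact ⟨k, by omega⟩)
  exact ⟨y, hy, by linear_combination h⟩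

/-- `ℤ[ω] / (1 - ω)` is the field with two elements. -/
lemma cycInt_mod (x : ℂ) (hx : x ∈ cycInt) :
    (∃ y ∈ cycInt, x = cycPrime * y) ∨ ∃ y ∈ cycInt, x = 1 + cycPrime * y := by
  by_cases h : ∀ y ∈ cycInt, x ≠ cycPrime * y
  · exact .inr (cycInt_sub_one hx h)
  · push Not at h
    exact .inl h

/-- Every element of `ℤ[ω]` prime to `1 - ω` is a power of `ω` modulo `(1 - ω)³`: the four powers
`1, ω, ω², ω³` represent all units of `ℤ[ω] / (1 - ω)³`. -/
lemma exists_omega8_pow_add {x : ℂ} (hx : x ∈ cycInt)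
    (hodd : ∀ y ∈ cycInt, x ≠ cycPrime * y) :
    ∃ m : ℕ, ∃ z ∈ cycInt, x = omega8 ^ m + cycPrime ^ 3 * z := by
  have hl : cycPrime = 1 - omega8 := rfl
  have ho := omega8_mem_cycInt
  have hc := cycPrime_mem_cycInt
  have h1 := one_mem cycInt
  -- modulo `(1 - ω)²` the element is `1` or `ω = 1 - (1 - ω)`
  have step1 : ∃ m : ℕ, ∃ z ∈ cycInt, x = omega8 ^ m * (1 + cycPrime ^ 2 * z) := by
    obtain ⟨y, hy, rfl⟩ := cycInt_sub_one hx hodd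
    rcases cycInt_mod y hy with ⟨z, hz, rfl⟩ | ⟨z, hz, rfl⟩
    · exact ⟨0, z, hz, by ring⟩
    · -- `1 + λ + λ² z = ω (1 + λ² z')` since `1 + λ = ω + 2 λ`
      obtain ⟨u, hu, h2⟩ : ∃ u ∈ cycInt, (2 : ℂ) = cycPrime * u := by
        refine ⟨_, ?_, two_eq_cycPrime.trans (by rw [pow_succ', mul_assoc])⟩
        exact mul_mem (pow_mem hc 2) (mul_mem hc (mul_mem (neg_mem (pow_mem ho 2))
          (pow_mem (add_mem h1 sqrt_two_mem_cycInt) 2)))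
      refine ⟨1, -omega8 ^ 3 * (z + u), mul_mem (neg_mem (pow_mem ho 3)) (add_mem hz hu), ?_⟩
      linear_combination cycPrime * h2 - hl + cycPrime ^ 2 * (z + u) * omega8_pow_four
  -- modulo `(1 - ω)³` the remaining factor is `1` or `ω²`
  obtain ⟨m, z, hz, rfl⟩ := step1
  rcases cycInt_mod z hz with ⟨y, hy, rfl⟩ | ⟨y, hy, rfl⟩
  · exact ⟨m, omega8 ^ m * y, mul_mem (pow_mem ho m) hy, by ring⟩
  · obtain ⟨u, hu, h2⟩ : ∃ u ∈ cycInt, (2 : ℂ) = cycPrime ^ 2 * u := by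
      refine ⟨_, ?_, two_eq_cycPrime.trans (by rw [pow_succ, mul_assoc])⟩
      exact mul_mem hc (mul_mem hc (mul_mem (neg_mem (pow_mem ho 2))
        (pow_mem (add_mem h1 sqrt_two_mem_cycInt) 2)))
    refine ⟨m + 2, omega8 ^ m * (y + u), mul_mem (pow_mem ho m) (add_mem hy hu), ?_⟩
    rw [pow_add]
    linear_combination omega8 ^ m * (cycPrime * h2 + (cycPrime + omega8 - 1 - 2 * omega8) * hl)

/-- Two elements of `ℤ[ω]` prime to `1 - ω` differ by a power of `ω` modulo `(1 - ω)³`. The Hadamard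
gate with this relative phase produces multiples of `(1 - ω)³` and divides them by `√2`, that is, by
`(1 - ω)²` up to a unit. -/
lemma exists_hadamard_reduction {x y : ℂ} (hx : x ∈ cycInt) (hy : y ∈ cycInt)
    (hx' : ∀ z ∈ cycInt, x ≠ cycPrime * z) (hy' : ∀ z ∈ cycInt, y ≠ cycPrime * z) :
    ∃ m : ℕ, (∃ z ∈ cycInt,
        Complex.I / (Real.sqrt 2 : ℂ) * (x + (omega8 ^ m)⁻¹ * y) = cycPrime * z) ∧
      ∃ z ∈ cycInt, Complex.I / (Real.sqrt 2 : ℂ) * (omega8 ^ m * x - y) = cycPrime * z := by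
  obtain ⟨a, z, hz, rfl⟩ := exists_omega8_pow_add hx hx'
  obtain ⟨b, w, hw, rfl⟩ := exists_omega8_pow_add hy hy'
  have ho := omega8_mem_cycInt
  have hc := cycPrime_mem_cycInt
  have h1 := one_mem cycInt
  have hs := sqrt_two_mem_cycInt
  -- multiplication by `(1 - ω)³ / √2` lands in `(1 - ω)`
  have key : ∀ t ∈ cycInt, ∃ z ∈ cycInt,
      Complex.I / (Real.sqrt 2 : ℂ) * (cycPrime ^ 3 * t) = cycPrime * z := by
    intro t ht
    refine ⟨Complex.I * (omega8 * (1 - (Real.sqrt 2 : ℂ))) * t,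
      mul_mem (mul_mem I_mem_cycInt (mul_mem ho (sub_mem h1 hs))) ht, ?_⟩
    rw [pow_succ, cycPrime_sq]
    field_simp [sqrt_two_ne_zero]
  have hm : omega8 ^ (b + 7 * a) * omega8 ^ a = omega8 ^ b := by
    rw [← pow_add, show b + 7 * a + a = b + 8 * a by ring, pow_add, pow_mul, omega8_pow_eight,
      one_pow, mul_one]
  have hm0 : omega8 ^ (b + 7 * a) ≠ 0 := pow_ne_zero _ omega8_ne_zero
  have hm' : (omega8 ^ (b + 7 * a))⁻¹ * omega8 ^ b = omega8 ^ a := by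
    rw [← hm, inv_mul_cancel_left₀ hm0]
  refine ⟨b + 7 * a, ?_, ?_⟩
  · obtain ⟨r, hr, e⟩ := key (cycPrime * (-omega8 ^ 2 * (1 + (Real.sqrt 2 : ℂ)) ^ 2) * omega8 ^ a +
      z + (omega8 ^ (b + 7 * a))⁻¹ * w)
      (add_mem (add_mem (mul_mem (mul_mem hc (mul_mem (neg_mem (pow_mem ho 2))
        (pow_mem (add_mem h1 hs) 2))) (pow_mem ho a)) hz)
        (mul_mem (omega8_pow_inv_mem_cycInt _) hw))
    refine ⟨r, hr, ?_⟩
    rw [← e]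
    congr 1
    linear_combination hm' + omega8 ^ a * two_eq_cycPrime
  · obtain ⟨r, hr, e⟩ := key (omega8 ^ (b + 7 * a) * z - w)
      (sub_mem (mul_mem (pow_mem ho _) hz) hw)
    refine ⟨r, hr, ?_⟩
    rw [← e]
    congr 1
    linear_combination hm

/-! ### Norms in `ℤ[√2]` -/

/-- The absolute square of `a + bω + cω² + dω³` is an element of `ℤ[√2]` with rational part
`a² + b² + c² + d²`. -/
lemma star_mul_self_cycInt {a b c d : ℤ} {x : ℂ}
    (hx : x = a + b * omega8 + c * omega8 ^ 2 + d * omega8 ^ 3) :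
    star x * x = (((a ^ 2 + b ^ 2 + c ^ 2 + d ^ 2 : ℤ) : ℝ) +
      ((a * b + b * c + c * d - d * a : ℤ) : ℝ) * Real.sqrt 2 : ℝ) := by
  have hz : ∀ z : ℤ, star (z : ℂ) = z := fun z => by simp
  have hs : star x = a + b * (-omega8 ^ 3) + c * (-omega8 ^ 3) ^ 2 + d * (-omega8 ^ 3) ^ 3 := by
    rw [hx]
    simp only [star_add, star_mul', star_pow, star_omega8, omega8_inv, hz]
  have h4 := omega8_pow_four
  push_cast
  rw [hs, hx, sqrt_two_eq_omega8]
  generalize omega8 = w at *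
  linear_combination (-d * d * w ^ 8 - c * d * w ^ 7 - b * d * w ^ 6 + (c * d - a * d) * w ^ 5 +
    (c * c + d * d) * w ^ 4 + (b * c + c * d) * w ^ 3 + a * c * w ^ 2 +
    (a * d - b * c - c * d) * w - (b * b + c * c + d * d) : ℂ) * h4

lemma sqrt_two_rational_part {a b c d : ℤ}
    (h : (a : ℝ) + b * Real.sqrt 2 = c + d * Real.sqrt 2) : a = c := by
  by_cases hbd : b = d
  · subst hbd; exact_mod_cast add_right_cancel h
  · exfalso
    have hne : ((b - d : ℤ) : ℝ) ≠ 0 := by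
      exact_mod_cast sub_ne_zero.mpr hbd
    refine irrational_sqrt_two ⟨((c - a : ℤ) : ℚ) / ((b - d : ℤ) : ℚ), ?_⟩
    push_cast at hne ⊢
    rw [div_eq_iff hne]
    linarith

/-- The positive powers of `|1 - ω|² = 2 - √2` have even rational part. -/
lemma star_mul_cycPrime_pow (k : ℕ) : ∃ a b : ℤ, Even a ∧
    star (cycPrime ^ (k + 1)) * cycPrime ^ (k + 1) = ((a : ℝ) + b * Real.sqrt 2 : ℝ) := by
  have hl : star cycPrime * cycPrime = ((2 - Real.sqrt 2 : ℝ) : ℂ) := by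
    have := star_mul_self_cycInt (a := 1) (b := -1) (c := 0) (d := 0) (x := cycPrime)
      (by simp [cycPrime]; ring)
    rw [this]; norm_num; ring
  induction k with
  | zero => exact ⟨2, -1, by norm_num, by rw [zero_add, pow_one, hl]; push_cast; ring⟩
  | succ k ih =>
    obtain ⟨a, b, ha, h⟩ := ih
    refine ⟨2 * a - 2 * b, 2 * b - a, (even_two_mul a).sub (even_two_mul b), ?_⟩
    rw [star_pow] at h ⊢
    have : star cycPrime ^ (k + 1 + 1) * cycPrime ^ (k + 1 + 1) =
      (star cycPrime ^ (k + 1) * cycPrime ^ (k + 1)) * (star cycPrime * cycPrime) := by ring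
    rw [this, h, hl]
    push_cast
    linear_combination (-b : ℂ) * sqrt_two_sq

section UnitVectors

variable {ι : Type*} [Fintype ι]

/-- For a vector over `ℤ[ω]` whose squared norm is a positive power of `|1 - ω|²`, the number of
entries prime to `1 - ω` is even: compare the rational parts in `ℤ[√2]` modulo `2`. -/
lemma even_card_odd (w : ι → ℂ) (k : ℕ) (hw : ∀ j, w j ∈ cycInt)
    (hsum : ∑ j, star (w j) * w j = star (cycPrime ^ (k + 1)) * cycPrime ^ (k + 1))
    (O : Finset ι) (hO : ∀ j, j ∈ O ↔ ∀ z ∈ cycInt, w j ≠ cycPrime * z) : Even O.card := by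
  have hrep : ∀ j, ∃ A B : ℤ, star (w j) * w j = ((A : ℝ) + B * Real.sqrt 2 : ℝ) ∧
      (Odd A ↔ j ∈ O) := by
    intro j
    have hpar : ∀ a b c d : ℤ, Even (a ^ 2 + b ^ 2 + c ^ 2 + d ^ 2) ↔ Even (a + b + c + d) := by
      intro a b c d
      simp only [Int.even_add, Int.even_pow' two_ne_zero]
    by_cases hj : j ∈ O
    · obtain ⟨a, b, c, d, h⟩ := hw j
      refine ⟨_, _, star_mul_self_cycInt h, iff_of_true ?_ hj⟩
      rw [← Int.not_even_iff_odd, hpar]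
      intro he
      obtain ⟨y, hy, hxy⟩ := exists_cycPrime_mul_of_even h he
      exact (hO j).mp hj y hy hxy
    · rw [hO] at hj
      push Not at hj
      obtain ⟨y, ⟨a, b, c, d, rfl⟩, h⟩ := hj
      have h' : w j = ((a + d : ℤ) : ℂ) + ((b - a : ℤ) : ℂ) * omega8 +
          ((c - b : ℤ) : ℂ) * omega8 ^ 2 + ((d - c : ℤ) : ℂ) * omega8 ^ 3 := by
        rw [h, cycPrime]; push_cast
        linear_combination (-d : ℂ) * omega8_pow_four
      refine ⟨_, _, star_mul_self_cycInt h', iff_of_false ?_ ?_⟩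
      · rw [Int.not_odd_iff_even, hpar]
        exact ⟨d, by ring⟩
      · rw [hO]; push Not
        exact ⟨_, ⟨a, b, c, d, rfl⟩, h⟩
  choose A B hAB hodd using hrep
  obtain ⟨a, b, ha, hab⟩ := star_mul_cycPrime_pow k
  have hA : ∑ j, A j = a := by
    apply sqrt_two_rational_part (b := ∑ j, B j) (d := b)
    have : ((∑ j, ((A j : ℝ) + B j * Real.sqrt 2) : ℝ) : ℂ) = ((a : ℝ) + b * Real.sqrt 2 : ℝ) := by
      rw [← hab, ← hsum, Complex.ofReal_sum]
      exact Finset.sum_congr rfl fun j _ => (hAB j).symm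
    have := Complex.ofReal_injective this
    rw [← this]; push_cast
    rw [Finset.sum_add_distrib, Finset.sum_mul]
  classical
  have hC : ∀ j, ∃ C : ℤ, A j = (if j ∈ O then 1 else 0) + (C + C) := by
    intro j
    by_cases hj : j ∈ O
    · obtain ⟨C, hC⟩ := (hodd j).mpr hj
      exact ⟨C, by rw [if_pos hj, hC]; ring⟩
    · obtain ⟨C, hC⟩ := Int.not_odd_iff_even.mp fun h => hj ((hodd j).mp h)
      exact ⟨C, by rw [if_neg hj, hC]; ring⟩
  choose C hC using hC
  rw [← hA, Finset.sum_congr rfl fun j _ => hC j, Finset.sum_add_distrib, Finset.sum_add_distrib,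
    Finset.sum_boole] at ha
  have := (Int.even_add.mp ha).mpr ⟨_, rfl⟩
  simpa using this

/-- A unit vector over `ℤ[ω]` is a standard basis vector up to a power of `ω`. -/
lemma exists_omega8_pow_of_unit (v : ι → ℂ) (hv : ∀ j, v j ∈ cycInt)
    (hsum : ∑ j, star (v j) * v j = 1) :
    ∃ i, ∃ m : ℕ, v i = omega8 ^ m ∧ ∀ j, j ≠ i → v j = 0 := by
  choose a b c d h using hv
  have hA : ∑ j, (a j ^ 2 + b j ^ 2 + c j ^ 2 + d j ^ 2) = 1 := by
    apply sqrt_two_rational_part (d := 0)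
      (b := ∑ j, (a j * b j + b j * c j + c j * d j - d j * a j))
    have : ((∑ j, (((a j ^ 2 + b j ^ 2 + c j ^ 2 + d j ^ 2 : ℤ) : ℝ) +
        ((a j * b j + b j * c j + c j * d j - d j * a j : ℤ) : ℝ) * Real.sqrt 2) : ℝ) : ℂ) =
        (1 : ℝ) := by
      rw [Complex.ofReal_one, ← hsum, Complex.ofReal_sum]
      exact Finset.sum_congr rfl fun j _ => (star_mul_self_cycInt (h j)).symm
    have := Complex.ofReal_injective this
    rw [Finset.sum_add_distrib, ← Finset.sum_mul] at this
    push_cast at this ⊢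
    linarith
  classical
  obtain ⟨N, hN⟩ : ∃ N : ι → ℤ, ∀ j, N j = a j ^ 2 + b j ^ 2 + c j ^ 2 + d j ^ 2 :=
    ⟨_, fun _ => rfl⟩
  simp only [← hN] at hA
  have hnn : ∀ j, 0 ≤ N j := fun j => by rw [hN]; positivity
  obtain ⟨i, hi⟩ : ∃ i, N i ≠ 0 := by
    by_contra! hcon
    simp [hcon] at hA
  have hsplit := Finset.add_sum_erase Finset.univ N (Finset.mem_univ i)
  have hrest : 0 ≤ ∑ j ∈ Finset.univ.erase i, N j := Finset.sum_nonneg fun j _ => hnn j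
  have hi0 := hnn i
  have hi1 : N i = 1 := by omega
  have h0 : ∑ j ∈ Finset.univ.erase i, N j = 0 := by omega
  rw [Finset.sum_eq_zero_iff_of_nonneg fun j _ => hnn j] at h0
  have hzero : ∀ j, j ≠ i → v j = 0 := by
    intro j hj
    have hj0 := h0 j (by simp [hj])
    rw [hN] at hj0
    have ha : a j = 0 := pow_eq_zero_iff two_ne_zero |>.mp (by
      linarith [sq_nonneg (a j), sq_nonneg (b j), sq_nonneg (c j), sq_nonneg (d j)])
    have hb : b j = 0 := pow_eq_zero_iff two_ne_zero |>.mp (by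
      linarith [sq_nonneg (a j), sq_nonneg (b j), sq_nonneg (c j), sq_nonneg (d j)])
    have hc : c j = 0 := pow_eq_zero_iff two_ne_zero |>.mp (by
      linarith [sq_nonneg (a j), sq_nonneg (b j), sq_nonneg (c j), sq_nonneg (d j)])
    have hd : d j = 0 := pow_eq_zero_iff two_ne_zero |>.mp (by
      linarith [sq_nonneg (a j), sq_nonneg (b j), sq_nonneg (c j), sq_nonneg (d j)])
    rw [h j, ha, hb, hc, hd]; simp
  rw [hN] at hi1
  have h4 := omega8_pow_four
  have hcoef : ∃ m : ℕ, v i = omega8 ^ m := by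
    rw [h i]
    generalize a i = p at hi1 ⊢
    generalize b i = q at hi1 ⊢
    generalize c i = r at hi1 ⊢
    generalize d i = s at hi1 ⊢
    have hsq : ∀ x : ℤ, x ^ 2 = 0 ∨ 1 ≤ x ^ 2 := fun x => by
      rcases eq_or_ne x 0 with rfl | hx
      · simp
      · exact .inr (Int.add_one_le_of_lt (sq_pos_iff.mpr hx))
    have h01 : ∀ x : ℤ, x ^ 2 = 0 → x = 0 := fun x hx => by simpa using hx
    have h11 : ∀ x : ℤ, x ^ 2 = 1 → x = 1 ∨ x = -1 := fun x hx => by simpa using hx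
    have hp := hsq p
    have hq := hsq q
    have hr := hsq r
    have hs := hsq s
    have hcases : (p ^ 2 = 1 ∧ q ^ 2 = 0 ∧ r ^ 2 = 0 ∧ s ^ 2 = 0) ∨
        (p ^ 2 = 0 ∧ q ^ 2 = 1 ∧ r ^ 2 = 0 ∧ s ^ 2 = 0) ∨
        (p ^ 2 = 0 ∧ q ^ 2 = 0 ∧ r ^ 2 = 1 ∧ s ^ 2 = 0) ∨
        (p ^ 2 = 0 ∧ q ^ 2 = 0 ∧ r ^ 2 = 0 ∧ s ^ 2 = 1) := by
      generalize p ^ 2 = p' at *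
      generalize q ^ 2 = q' at *
      generalize r ^ 2 = r' at *
      generalize s ^ 2 = s' at *
      omega
    rcases hcases with ⟨hp, hq, hr, hs⟩ | ⟨hp, hq, hr, hs⟩ | ⟨hp, hq, hr, hs⟩ | ⟨hp, hq, hr, hs⟩
    · rw [h01 _ hq, h01 _ hr, h01 _ hs]
      rcases h11 _ hp with rfl | rfl
      · exact ⟨0, by simp⟩
      · exact ⟨4, by push_cast; linear_combination -h4⟩
    · rw [h01 _ hp, h01 _ hr, h01 _ hs]
      rcases h11 _ hq with rfl | rfl
      · exact ⟨1, by simp⟩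
      · exact ⟨5, by push_cast; linear_combination -omega8 * h4⟩
    · rw [h01 _ hp, h01 _ hq, h01 _ hs]
      rcases h11 _ hr with rfl | rfl
      · exact ⟨2, by simp⟩
      · exact ⟨6, by push_cast; linear_combination -omega8 ^ 2 * h4⟩
    · rw [h01 _ hp, h01 _ hq, h01 _ hr]
      rcases h11 _ hs with rfl | rfl
      · exact ⟨3, by simp⟩
      · exact ⟨7, by push_cast; linear_combination -omega8 ^ 3 * h4⟩
  obtain ⟨m, hm⟩ := hcoef
  exact ⟨i, m, hm, hzero⟩

end UnitVectors

/-! ### Two-level operators -/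

section TwoLevel

variable {ι : Type*} [Fintype ι] [DecidableEq ι]

/-- The two-level operator acting as `M` on the basis states `i`, `j` (in this order) and as the
identity on all others. -/
def twoLevel (i j : ι) (M : Matrix (Fin 2) (Fin 2) ℂ) : Matrix ι ι ℂ :=
  fun a b =>
    if a = i then M 0 0 * (if b = i then 1 else 0) + M 0 1 * (if b = j then 1 else 0)
    else if a = j then M 1 0 * (if b = i then 1 else 0) + M 1 1 * (if b = j then 1 else 0)
    else if b = a then 1 else 0

lemma twoLevel_mulVec (i j : ι) (M : Matrix (Fin 2) (Fin 2) ℂ) (v : ι → ℂ) (a : ι) :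
    (twoLevel i j M *ᵥ v) a =
      if a = i then M 0 0 * v i + M 0 1 * v j
      else if a = j then M 1 0 * v i + M 1 1 * v j else v a := by
  unfold twoLevel
  simp only [mulVec, dotProduct]
  split_ifs <;> simp [add_mul, Finset.sum_add_distrib]

lemma ext_of_mulVec {A B : Matrix ι ι ℂ} (h : ∀ v a, (A *ᵥ v) a = (B *ᵥ v) a) : A = B :=
  Matrix.ext_of_mulVec_single fun _ => funext (h _)

lemma twoLevel_mul {i j : ι} (hij : i ≠ j) (M N : Matrix (Fin 2) (Fin 2) ℂ) :
    twoLevel i j M * twoLevel i j N = twoLevel i j (M * N) := by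
  refine ext_of_mulVec fun v a => ?_
  rw [← mulVec_mulVec]
  simp only [twoLevel_mulVec, Matrix.mul_apply, Fin.sum_univ_two]
  split_ifs <;> simp_all <;> ring

lemma twoLevel_conjTranspose {ι : Type*} [DecidableEq ι] {i j : ι} (hij : i ≠ j)
    (M : Matrix (Fin 2) (Fin 2) ℂ) :
    (twoLevel i j M)ᴴ = twoLevel i j Mᴴ := by
  ext a b
  simp only [conjTranspose_apply, twoLevel]
  by_cases ha : a = i <;> by_cases ha' : a = j <;> by_cases hb : b = i <;> by_cases hb' : b = j <;>
    simp_all [eq_comm]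

lemma twoLevel_swap {i j : ι} (hij : i ≠ j) (M : Matrix (Fin 2) (Fin 2) ℂ) :
    twoLevel j i M = twoLevel i j !![M 1 1, M 1 0; M 0 1, M 0 0] := by
  refine ext_of_mulVec fun v a => ?_
  simp only [twoLevel_mulVec]
  split_ifs <;> simp_all <;> ring

/-- Conjugation by a rotation in the plane of `j`, `k` moves an operator from `i`, `j` to
`i`, `k`. -/
lemma twoLevel_conj {i j k : ι} (hij : i ≠ j) (hjk : j ≠ k) (hik : i ≠ k)
    (M : Matrix (Fin 2) (Fin 2) ℂ) :
    twoLevel j k !![0, -1; 1, 0] * twoLevel i j M * twoLevel j k !![0, 1; -1, 0] =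
      twoLevel i k M := by
  refine ext_of_mulVec fun v a => ?_
  rw [← mulVec_mulVec, ← mulVec_mulVec]
  have h1 := hij.symm
  have h2 := hjk.symm
  have h3 := hik.symm
  simp only [twoLevel_mulVec]
  by_cases ha : a = i
  · subst ha; simp [*]
  · by_cases ha' : a = j
    · subst ha'; simp [*]
    · by_cases ha'' : a = k
      · subst ha''; simp [*]
      · simp [*]

/-- The Hadamard gate with the phase `ω ^ m`, made of determinant one by the factor `i`. -/
noncomputable def phasedHadamard (m : ℕ) : Matrix (Fin 2) (Fin 2) ℂ :=
  (Complex.I / (Real.sqrt 2 : ℂ)) • !![1, (omega8 ^ m)⁻¹; omega8 ^ m, -1]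

lemma I_div_sqrt_two_sq : (Complex.I / (Real.sqrt 2 : ℂ)) * (Complex.I / (Real.sqrt 2 : ℂ)) =
    -1 / 2 := by
  rw [div_mul_div_comm, Complex.I_mul_I, ← sq, sqrt_two_sq]

lemma omega8_pow_add_four (m : ℕ) : omega8 ^ (m + 4) = -omega8 ^ m := by
  rw [pow_add, omega8_pow_four]; ring

/-- The antidiagonal operators of determinant one are products of two phased Hadamard gates. -/
lemma phasedHadamard_mul (m : ℕ) : phasedHadamard (m + 4) * phasedHadamard m =
    !![0, -(omega8 ^ m)⁻¹; omega8 ^ m, 0] := by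
  have h := I_div_sqrt_two_sq
  have h0 : omega8 ^ m ≠ 0 := pow_ne_zero _ omega8_ne_zero
  rw [phasedHadamard, phasedHadamard, smul_mul_smul_comm, h, omega8_pow_add_four]
  ext i j
  fin_cases i <;> fin_cases j <;> simp [h0, inv_neg] <;> ring

/-- Exchanging the two basis states turns a phased Hadamard gate into the inverse of another one. -/
lemma phasedHadamard_conjTranspose_swap (m : ℕ) :
    !![phasedHadamard m 1 1, phasedHadamard m 1 0; phasedHadamard m 0 1, phasedHadamard m 0 0] =
      (phasedHadamard (7 * m + 4))ᴴ := by
  have h : omega8 ^ (7 * m + 4) = -(omega8 ^ m)⁻¹ := by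
    rw [omega8_pow_add_four, neg_inj]
    apply eq_inv_of_mul_eq_one_left
    rw [← pow_add, show 7 * m + m = 8 * m by ring, pow_mul, omega8_pow_eight, one_pow]
  have hs : (starRingEnd ℂ) (omega8 ^ m) = (omega8 ^ m)⁻¹ := star_omega8_pow m
  simp only [phasedHadamard, h]
  generalize omega8 ^ m = c at hs
  ext i j
  fin_cases i <;> fin_cases j <;> simp [conjTranspose_apply, hs] <;> ring

end TwoLevel

/-! ### Column reduction of isometries over `ℤ[ω, 1/2]` -/

section Column

variable {ι : Type*} [Fintype ι] [DecidableEq ι]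

lemma star_dotProduct_mulVec_of_isometry {U : Matrix ι ι ℂ} (hU : Uᴴ * U = 1) (v : ι → ℂ) :
    ∑ a, star ((U *ᵥ v) a) * (U *ᵥ v) a = ∑ a, star (v a) * v a := by
  have h : star (U *ᵥ v) ⬝ᵥ (U *ᵥ v) = star v ⬝ᵥ v := by
    rw [star_mulVec, dotProduct_mulVec, vecMul_vecMul, hU, vecMul_one]
  simpa [dotProduct] using h

/-- Reduction of the denominator: a unit vector over `ℤ[ω]` divided by a power of `1 - ω` is turned
into one over `ℤ[ω]`, by phased Hadamard gates acting on pairs of entries with maximal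
denominator. -/
lemma exists_mulVec_mem_cycInt (G : Submonoid (Matrix ι ι ℂ)) (hG : ∀ g ∈ G, gᴴ * g = 1)
    (A : Set ι) (hA : ∀ i ∈ A, ∀ j ∈ A, i ≠ j → ∀ m, twoLevel i j (phasedHadamard m) ∈ G)
    (k : ℕ) : ∀ v : ι → ℂ, (∀ i, i ∉ A → v i = 0) → ∑ a, star (v a) * v a = 1 →
      (∀ i, cycPrime ^ k * v i ∈ cycInt) →
      ∃ g ∈ G, (∀ i, i ∉ A → (g *ᵥ v) i = 0) ∧ ∀ i, (g *ᵥ v) i ∈ cycInt := by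
  classical
  induction k with
  | zero =>
    intro v hv _ hk
    exact ⟨1, one_mem _, by simpa using hv, by simpa using hk⟩
  | succ k ihk =>
    -- inner induction on the number of entries prime to `1 - ω`
    intro v
    induction hn : (Finset.univ.filter fun i => cycPrime ^ k * v i ∉ cycInt).card
      using Nat.strong_induction_on generalizing v with
    | _ n ih =>
    intro hv hnorm hk
    set O := Finset.univ.filter fun i => cycPrime ^ k * v i ∉ cycInt with hOdef
    have hO : ∀ j, j ∈ O ↔ ∀ z ∈ cycInt, cycPrime ^ (k + 1) * v j ≠ cycPrime * z := by
      intro j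
      rw [hOdef, Finset.mem_filter, and_iff_right (Finset.mem_univ j)]
      constructor
      · rintro h z hz e
        rw [pow_succ', mul_assoc] at e
        exact h (mul_left_cancel₀ cycPrime_ne_zero e ▸ hz)
      · intro h hz
        exact h _ hz (by rw [pow_succ', mul_assoc])
    have heven : Even O.card := by
      refine even_card_odd (fun j => cycPrime ^ (k + 1) * v j) k hk ?_ O hO
      calc ∑ j, star (cycPrime ^ (k + 1) * v j) * (cycPrime ^ (k + 1) * v j)
          = ∑ j, star (cycPrime ^ (k + 1)) * cycPrime ^ (k + 1) * (star (v j) * v j) :=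
            Finset.sum_congr rfl fun j _ => by rw [star_mul']; ring
        _ = _ := by rw [← Finset.mul_sum, hnorm, mul_one]
    rcases Finset.eq_empty_or_nonempty O with hemp | hne
    · refine ihk v hv hnorm fun i => ?_
      by_contra hi
      have : i ∈ O := by simp [hOdef, hi]
      simp [hemp] at this
    · have h2 : 1 < O.card := by
        have := hne.card_pos
        obtain ⟨r, hr⟩ := heven
        omega
      obtain ⟨i, hi, j, hj, hij⟩ := Finset.one_lt_card.mp h2
      have hmem : ∀ i ∈ O, i ∈ A := by
        intro i hi
        by_contra hiA
        have := (hO i).mp hi 0 (zero_mem _)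
        simp [hv i hiA] at this
      obtain ⟨m, ⟨z, hz, ez⟩, z', hz', ez'⟩ :=
        exists_hadamard_reduction (hk i) (hk j) ((hO i).mp hi) ((hO j).mp hj)
      have hg := hA i (hmem i hi) j (hmem j hj) hij m
      set g := twoLevel i j (phasedHadamard m)
      have hgi : cycPrime ^ k * (g *ᵥ v) i = z := by
        apply mul_left_cancel₀ cycPrime_ne_zero
        rw [← ez, twoLevel_mulVec, if_pos rfl]
        simp [phasedHadamard]; ring
      have hgj : cycPrime ^ k * (g *ᵥ v) j = z' := by
        apply mul_left_cancel₀ cycPrime_ne_zero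
        rw [← ez', twoLevel_mulVec, if_neg hij.symm, if_pos rfl]
        simp [phasedHadamard]; ring
      have hgo : ∀ a, a ≠ i → a ≠ j → (g *ᵥ v) a = v a := fun a ha ha' => by
        rw [twoLevel_mulVec, if_neg ha, if_neg ha']
      have hlt : (Finset.univ.filter fun a => cycPrime ^ k * (g *ᵥ v) a ∉ cycInt).card < n := by
        rw [← hn]
        apply Finset.card_lt_card
        rw [Finset.ssubset_iff_of_subset]
        · exact ⟨i, hi, by simp [hgi, hz]⟩
        · intro a ha
          have hai : a ≠ i := by rintro rfl; simp [hgi, hz] at ha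
          have haj : a ≠ j := by rintro rfl; simp [hgj, hz'] at ha
          simpa [hOdef, hgo a hai haj] using ha
      obtain ⟨g', hg', h1, h2⟩ := ih _ hlt (g *ᵥ v) rfl
        (fun a ha => by
          rw [hgo a (fun h => ha (h ▸ hmem i hi)) (fun h => ha (h ▸ hmem j hj)), hv a ha])
        (by rw [star_dotProduct_mulVec_of_isometry (hG g hg), hnorm])
        (fun a => by
          by_cases hai : a = i
          · rw [hai, pow_succ', mul_assoc, hgi]; exact mul_mem cycPrime_mem_cycInt hz
          · by_cases haj : a = j
            · rw [haj, pow_succ', mul_assoc, hgj]; exact mul_mem cycPrime_mem_cycInt hz'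
            · rw [hgo a hai haj]; exact hk a)
      exact ⟨g' * g, mul_mem hg' hg, by rwa [← mulVec_mulVec], by rwa [← mulVec_mulVec]⟩

/-- Every unit vector over `ℤ[ω, 1/2]` supported in `A` can be mapped to a given basis state of `A`.
A second element of `A` is needed to get rid of the last phase. -/
lemma exists_mulVec_eq_single (G : Submonoid (Matrix ι ι ℂ)) (hG : ∀ g ∈ G, gᴴ * g = 1)
    (A : Set ι) (hA : ∀ i ∈ A, ∀ j ∈ A, i ≠ j → ∀ m, twoLevel i j (phasedHadamard m) ∈ G)
    (i₀ j₀ : ι) (hi₀ : i₀ ∈ A) (hj₀ : j₀ ∈ A) (hne : i₀ ≠ j₀)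
    (k : ℕ) (v : ι → ℂ) (hv : ∀ i, i ∉ A → v i = 0) (hnorm : ∑ a, star (v a) * v a = 1)
    (hk : ∀ i, cycPrime ^ k * v i ∈ cycInt) :
    ∃ g ∈ G, g *ᵥ v = Pi.single i₀ 1 := by
  obtain ⟨g, hg, hsupp, hint⟩ := exists_mulVec_mem_cycInt G hG A hA k v hv hnorm hk
  obtain ⟨i, m, him, hrest⟩ := exists_omega8_pow_of_unit (g *ᵥ v) hint
    (by rw [star_dotProduct_mulVec_of_isometry (hG g hg), hnorm])
  have hiA : i ∈ A := by
    by_contra h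
    rw [hsupp i h] at him
    exact pow_ne_zero m omega8_ne_zero him.symm
  have hgv : g *ᵥ v = Pi.single i (omega8 ^ m) := by
    ext a
    by_cases ha : a = i
    · subst ha; simpa using him
    · rw [hrest a ha, Pi.single_eq_of_ne ha]
  -- moving a basis state while changing its phase by a power of `ω`
  have hmove : ∀ i ∈ A, ∀ j ∈ A, i ≠ j → ∀ m : ℕ, ∃ h ∈ G, ∀ c : ℂ,
      h *ᵥ Pi.single i c = Pi.single j (omega8 ^ m * c) := by
    intro i hi j hj hij m
    refine ⟨_, mul_mem (hA i hi j hj hij (m + 4)) (hA i hi j hj hij m), fun c => ?_⟩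
    rw [twoLevel_mul hij, phasedHadamard_mul]
    ext a
    rw [twoLevel_mulVec]
    by_cases hai : a = i
    · subst hai; simp [hij]
    · by_cases haj : a = j
      · subst haj; simp [hij.symm]
      · simp [hai, haj]
  have hcancel : omega8 ^ (7 * m) * omega8 ^ m = 1 := by
    rw [← pow_add, show 7 * m + m = 8 * m by ring, pow_mul, omega8_pow_eight, one_pow]
  by_cases hii : i = i₀
  · subst hii
    obtain ⟨h₁, hh₁, e₁⟩ := hmove i hi₀ j₀ hj₀ hne (7 * m)
    obtain ⟨h₂, hh₂, e₂⟩ := hmove j₀ hj₀ i hi₀ hne.symm 0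
    refine ⟨h₂ * (h₁ * g), mul_mem hh₂ (mul_mem hh₁ hg), ?_⟩
    rw [← mulVec_mulVec, ← mulVec_mulVec, hgv, e₁, e₂, hcancel]
    simp
  · obtain ⟨h, hh, e⟩ := hmove i hiA i₀ hi₀ hii (7 * m)
    refine ⟨h * g, mul_mem hh hg, ?_⟩
    rw [← mulVec_mulVec, hgv, e, hcancel]

/-- The ring `ℤ[ω, 1/2]`, obtained from `ℤ[ω]` by inverting `1 - ω`. -/
def cycLoc : Subring ℂ where
  carrier := {x | ∃ k : ℕ, cycPrime ^ k * x ∈ cycInt}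
  mul_mem' := by
    rintro x y ⟨k, hk⟩ ⟨l, hl⟩
    refine ⟨k + l, ?_⟩
    rw [pow_add, mul_mul_mul_comm]
    exact mul_mem hk hl
  one_mem' := ⟨0, by simp⟩
  add_mem' := by
    rintro x y ⟨k, hk⟩ ⟨l, hl⟩
    refine ⟨k + l, ?_⟩
    have : cycPrime ^ (k + l) * (x + y) =
      cycPrime ^ l * (cycPrime ^ k * x) + cycPrime ^ k * (cycPrime ^ l * y) := by ring
    rw [this]
    exact add_mem (mul_mem (pow_mem cycPrime_mem_cycInt l) hk)
      (mul_mem (pow_mem cycPrime_mem_cycInt k) hl)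
  zero_mem' := ⟨0, by simp⟩
  neg_mem' := by
    rintro x ⟨k, hk⟩
    exact ⟨k, by rw [mul_neg]; exact neg_mem hk⟩

lemma cycInt_le_cycLoc : cycInt ≤ cycLoc := fun x hx => ⟨0, by simpa using hx⟩

lemma inv_sqrt_two_mem_cycLoc : ((Real.sqrt 2 : ℝ) : ℂ)⁻¹ ∈ cycLoc := by
  refine ⟨2, ?_⟩
  rw [cycPrime_sq, mul_comm, inv_mul_cancel_left₀ sqrt_two_ne_zero]
  exact mul_mem omega8_mem_cycInt (sub_mem (one_mem _) sqrt_two_mem_cycInt)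

lemma inv_two_mem_cycLoc : (2 : ℂ)⁻¹ ∈ cycLoc := by
  rw [← sqrt_two_sq, ← inv_pow]
  exact pow_mem inv_sqrt_two_mem_cycLoc 2

lemma exists_common_cycPrime_pow (v : ι → ℂ) (hv : ∀ i, v i ∈ cycLoc) :
    ∃ k : ℕ, ∀ i, cycPrime ^ k * v i ∈ cycInt := by
  choose k hk using hv
  refine ⟨∑ i, k i, fun i => ?_⟩
  rw [← Finset.sum_erase_add _ _ (Finset.mem_univ i), pow_add, mul_assoc]
  exact mul_mem (pow_mem cycPrime_mem_cycInt _) (hk i)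

/-- Column-by-column reduction: every isometry over `ℤ[ω, 1/2]` with more rows than columns is
mapped to a partial identity by two-level phased Hadamard gates. -/
lemma exists_mul_eq_partial_one (G : Submonoid (Matrix ι ι ℂ)) (hG : ∀ g ∈ G, gᴴ * g = 1)
    (hloc : ∀ g ∈ G, ∀ a b, g a b ∈ cycLoc)
    (hE : ∀ i j, i ≠ j → ∀ m, twoLevel i j (phasedHadamard m) ∈ G)
    {κ : Type*} [Fintype κ] [DecidableEq κ] (f : κ → ι) (hf : Function.Injective f)
    (hcard : Fintype.card κ < Fintype.card ι) (K : Matrix ι κ ℂ) (hK : Kᴴ * K = 1)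
    (hKloc : ∀ a b, K a b ∈ cycLoc) :
    ∃ g ∈ G, g * K = Matrix.of fun a b => if a = f b then 1 else 0 := by
  suffices h : ∀ S : Finset κ, ∃ g ∈ G, ∀ b ∈ S, ∀ a, (g * K) a b = if a = f b then 1 else 0 by
    obtain ⟨g, hg, e⟩ := h Finset.univ
    exact ⟨g, hg, Matrix.ext fun a b => e b (Finset.mem_univ b) a⟩
  intro S
  induction S using Finset.induction_on with
  | empty => exact ⟨1, one_mem _, by simp⟩
  | insert b₀ S hb₀ ih =>
    obtain ⟨g, hg, hS⟩ := ih
    have hiso : (g * K)ᴴ * (g * K) = 1 := by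
      rw [conjTranspose_mul, Matrix.mul_assoc, ← Matrix.mul_assoc gᴴ, hG g hg, Matrix.one_mul, hK]
    set v : ι → ℂ := fun a => (g * K) a b₀ with hvdef
    set A : Set ι := {a | ∀ b ∈ S, a ≠ f b} with hAdef
    have hb₀A : f b₀ ∈ A := fun b hb e => hb₀ (hf e ▸ hb)
    obtain ⟨j₀, hj₀⟩ : ∃ j, ∀ b, f b ≠ j := by
      by_contra! hcon
      exact absurd (Fintype.card_le_of_surjective f hcon) (not_le.mpr hcard)
    have hloc' : ∀ a, v a ∈ cycLoc := fun a => by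
      simp only [hvdef, Matrix.mul_apply]
      exact sum_mem fun c _ => mul_mem (hloc g hg a c) (hKloc c b₀)
    obtain ⟨k, hk⟩ := exists_common_cycPrime_pow v hloc'
    -- operators fixing the columns already treated
    let G' : Submonoid (Matrix ι ι ℂ) :=
      { carrier := {h | h ∈ G ∧ ∀ a, a ∉ A → h *ᵥ Pi.single a 1 = Pi.single a 1}
        one_mem' := ⟨one_mem _, fun a _ => one_mulVec _⟩
        mul_mem' := by
          rintro x y ⟨hx, hx'⟩ ⟨hy, hy'⟩
          exact ⟨mul_mem hx hy, fun a ha => by rw [← mulVec_mulVec, hy' a ha, hx' a ha]⟩ }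
    have hnorm : ∑ a, star (v a) * v a = 1 := by
      have := congrFun (congrFun hiso b₀) b₀
      rw [Matrix.mul_apply, Matrix.one_apply_eq] at this
      exact this
    have hsupp : ∀ a, a ∉ A → v a = 0 := by
      intro a ha
      have ha' : ¬ ∀ b ∈ S, a ≠ f b := ha
      push Not at ha'
      obtain ⟨b, hb, rfl⟩ := ha'
      have hbb : b ≠ b₀ := fun h => hb₀ (h ▸ hb)
      have := congrFun (congrFun hiso b) b₀
      rw [Matrix.mul_apply, Matrix.one_apply_ne hbb] at this
      simpa [conjTranspose_apply, hS b hb, hvdef] using this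
    obtain ⟨h, ⟨hhG, hfix⟩, hv⟩ := exists_mulVec_eq_single G' (fun h hh => hG h hh.1) A
      (fun i hi j hj hij m => ⟨hE i j hij m, fun a ha => by
        have hai : a ≠ i := fun e => ha (e ▸ hi)
        have haj : a ≠ j := fun e => ha (e ▸ hj)
        ext c
        rw [twoLevel_mulVec]
        by_cases hci : c = i
        · subst hci; simp [haj, hai.symm]
        · by_cases hcj : c = j
          · subst hcj; simp [hai, haj.symm]
          · simp [hci, hcj]⟩)
      (f b₀) j₀ hb₀A (fun b _ e => hj₀ b e.symm) (hj₀ b₀) k v hsupp hnorm hk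
    refine ⟨h * g, mul_mem hhG hg, fun b hb a => ?_⟩
    rw [Matrix.mul_assoc]
    have hcol : (h * (g * K)) a b = (h *ᵥ fun c => (g * K) c b) a := rfl
    rw [hcol]
    rcases Finset.mem_insert.mp hb with rfl | hb
    · rw [show (fun c => (g * K) c b) = v from rfl, hv, Pi.single_apply]
    · have : (fun c => (g * K) c b) = Pi.single (f b) 1 := by
        ext c; rw [hS b hb, Pi.single_apply]
      rw [this, hfix (f b) (fun hA' => hA' b hb rfl), Pi.single_apply]

end Column

/-! ### The monoid of circuit operators -/

section CircuitGroup

variable {Q : Type} [Fintype Q] [DecidableEq Q]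

lemma Circuit.op_append (c d : Circuit Q) : Circuit.op (c ++ d) = Circuit.op d * Circuit.op c := by
  induction c with
  | nil => simp [Circuit.op]
  | cons g c ih => simp [Circuit.op, ih, Matrix.mul_assoc]

/-- The operators performed by Clifford+T circuits on the register `Q`. -/
def circuitOps (Q : Type) [Fintype Q] [DecidableEq Q] : Submonoid (QOp Q) where
  carrier := {U | ∃ c : Circuit Q, Circuit.op c = U}
  one_mem' := ⟨[], rfl⟩
  mul_mem' := by
    rintro _ _ ⟨c, rfl⟩ ⟨d, rfl⟩
    exact ⟨d ++ c, Circuit.op_append d c⟩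

lemma Gate.op_mem_circuitOps (g : Gate Q) : g.op ∈ circuitOps Q :=
  ⟨[g], by simp [Circuit.op]⟩

/-! ### Operators that act on one qubit, controlled by the others -/

/-- A sum over all labels that agree with `a` off the qubit `t` is a sum over the value at `t`. -/
lemma sum_agree (t : Q) (a : Bits Q) (F : Bits Q → ℂ) :
    ∑ c, (if ∀ r, r ≠ t → a r = c r then F c else 0) = ∑ s, F (Function.update a t s) := by
  symm
  refine Finset.sum_of_injOn (fun s => Function.update a t s)
    (fun x _ y _ h => Function.update_injective a t h)
    (fun _ _ => Finset.mem_coe.mpr (Finset.mem_univ _)) ?_ ?_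
  · intro c _ hc
    rw [if_neg]
    intro h
    refine hc ⟨c t, by simp, ?_⟩
    ext r
    by_cases hr : r = t
    · subst hr; simp
    · simp [hr, h r hr]
  · intro s _
    rw [if_pos]
    intro r hr
    simp [hr]

/-- The operator acting on the qubit `t` by `A b`, where `b` is the state of the register; it is
meant for families `A` that do not depend on the value of `b` at `t`. -/
def controlled (t : Q) (A : Bits Q → Matrix (Fin 2) (Fin 2) ℂ) : QOp Q :=
  fun a b => if ∀ r, r ≠ t → a r = b r then A a (a t) (b t) else 0

lemma controlled_mul (t : Q) (A B : Bits Q → Matrix (Fin 2) (Fin 2) ℂ)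
    (hB : ∀ a s, B (Function.update a t s) = B a) :
    controlled t A * controlled t B = controlled t (fun a => A a * B a) := by
  ext a b
  simp only [Matrix.mul_apply, controlled, ite_mul, zero_mul]
  rw [sum_agree t a (fun c => A a (a t) (c t) *
    (if ∀ r, r ≠ t → c r = b r then B c (c t) (b t) else 0))]
  have h : ∀ s, (∀ r, r ≠ t → Function.update a t s r = b r) ↔ ∀ r, r ≠ t → a r = b r := by
    intro s
    refine forall_congr' fun r => forall_congr' fun hr => ?_
    simp [hr]
  simp only [h, hB, Function.update_self]
  split_ifs <;> simp

lemma onQubit_eq_controlled (M : Matrix (Fin 2) (Fin 2) ℂ) (t : Q) :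
    onQubit M t = controlled t (fun _ => M) := rfl

lemma onQubit_mul (M N : Matrix (Fin 2) (Fin 2) ℂ) (t : Q) :
    onQubit M t * onQubit N t = onQubit (M * N) t := by
  simp only [onQubit_eq_controlled]
  exact controlled_mul t _ _ fun _ _ => rfl

lemma onQubit_one (t : Q) : onQubit 1 t = 1 := by
  ext a b
  simp only [onQubit, Matrix.one_apply]
  by_cases h : a = b
  · subst h; simp
  · rw [if_neg h]
    by_cases h' : ∀ r, r ≠ t → a r = b r
    · rw [if_pos h', if_neg]
      intro ht
      exact h (funext fun r => if hr : r = t then hr ▸ ht else h' r hr)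
    · rw [if_neg h']

lemma onQubit_pow (M : Matrix (Fin 2) (Fin 2) ℂ) (t : Q) (k : ℕ) :
    onQubit M t ^ k = onQubit (M ^ k) t := by
  induction k with
  | zero => simp [onQubit_one]
  | succ k ih => rw [pow_succ, ih, onQubit_mul, pow_succ]

lemma onQubit_conjTranspose (M : Matrix (Fin 2) (Fin 2) ℂ) (t : Q) :
    (onQubit M t)ᴴ = onQubit Mᴴ t := by
  ext a b
  simp only [onQubit, conjTranspose_apply, apply_ite star, star_zero]
  refine if_congr ?_ rfl rfl
  exact forall_congr' fun r => forall_congr' fun _ => eq_comm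

lemma diagonal_eq_controlled (t : Q) (d : Bits Q → ℂ) :
    diagonal d = controlled t
      (fun a => diagonal fun s => d (Function.update a t s)) := by
  ext a b
  simp only [controlled, diagonal_apply]
  by_cases h : a = b
  · subst h; simp
  · rw [if_neg h]
    by_cases h' : ∀ r, r ≠ t → a r = b r
    · rw [if_pos h', if_neg]
      intro ht
      exact h (funext fun r => if hr : r = t then hr ▸ ht else h' r hr)
    · rw [if_neg h']

/-! ### Circuit operators are unitary over `ℤ[ω, 1/2]` -/

lemma hadamard_eq : hadamard = ((Real.sqrt 2 : ℝ) : ℂ)⁻¹ • !![1, 1; 1, -1] := by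
  rw [hadamard]; push_cast; rw [one_div]

lemma hadamard_mul_self : hadamard * hadamard = 1 := by
  have h : ((Real.sqrt 2 : ℝ) : ℂ)⁻¹ * ((Real.sqrt 2 : ℝ) : ℂ)⁻¹ = 1 / 2 := by
    rw [← mul_inv, ← sq, sqrt_two_sq, one_div]
  rw [hadamard_eq, smul_mul_smul_comm, h]
  ext i j
  fin_cases i <;> fin_cases j <;> norm_num [Matrix.mul_apply, Fin.sum_univ_two]

lemma hadamard_conjTranspose : hadamardᴴ = hadamard := by
  rw [hadamard_eq]
  ext i j
  fin_cases i <;> fin_cases j <;> simp [conjTranspose_apply]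

lemma tGate_eq_diagonal : tGate = diagonal ![1, omega8] := by
  ext i j
  fin_cases i <;> fin_cases j <;> simp [tGate]

lemma tGate_pow (k : ℕ) : tGate ^ k = diagonal ![1, omega8 ^ k] := by
  rw [tGate_eq_diagonal, diagonal_pow]
  congr 1
  ext i
  fin_cases i <;> simp

lemma tGate_conjTranspose : tGateᴴ = tGate ^ 7 := by
  have : (starRingEnd ℂ) omega8 = omega8 ^ 7 := by
    rw [show (starRingEnd ℂ) omega8 = star omega8 from rfl, star_omega8, omega8_inv]
    linear_combination -omega8 ^ 3 * omega8_pow_four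
  rw [tGate_pow, tGate]
  ext i j
  fin_cases i <;> fin_cases j <;> simp [conjTranspose_apply, this]

lemma tGate_conjTranspose_mul_self : tGateᴴ * tGate = 1 := by
  rw [tGate_conjTranspose, ← pow_succ, tGate_pow, omega8_pow_eight]
  ext i j
  fin_cases i <;> fin_cases j <;> simp

/-- The operator `|b⟩ ↦ |σ b⟩`. -/
def basisMap (σ : Bits Q → Bits Q) : QOp Q := fun a b => if a = σ b then 1 else 0

lemma mul_basisMap (M : QOp Q) (σ : Bits Q → Bits Q) : M * basisMap σ = M.submatrix id σ := by
  ext a b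
  simp [Matrix.mul_apply, basisMap]

lemma basisMap_mul_basisMap (σ τ : Bits Q → Bits Q) :
    basisMap σ * basisMap τ = basisMap (σ ∘ τ) := by
  rw [mul_basisMap]; rfl

lemma basisMap_id {Q : Type} [Fintype Q] : basisMap (id : Bits Q → Bits Q) = 1 := by
  ext a b; simp [basisMap, Matrix.one_apply]

lemma conjTranspose_basisMap_mul (M : QOp Q) (σ : Bits Q → Bits Q) :
    (basisMap σ)ᴴ * M = M.submatrix σ id := by
  ext a b
  simp [Matrix.mul_apply, basisMap, conjTranspose_apply, apply_ite]

lemma basisMap_conjTranspose_of_involutive {Q : Type} [Fintype Q] {σ : Bits Q → Bits Q}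
    (hσ : Function.Involutive σ) :
    (basisMap σ)ᴴ = basisMap σ := by
  ext a b
  simp only [conjTranspose_apply, basisMap, apply_ite star, star_one, star_zero]
  refine if_congr ⟨fun h => ?_, fun h => ?_⟩ rfl rfl
  · rw [h, hσ]
  · rw [h, hσ]

/-- The map adding `f b` to the qubit `t` of the basis state `b`. -/
def flipQubit (t : Q) (f : Bits Q → Fin 2) (b : Bits Q) : Bits Q := Function.update b t (b t + f b)

lemma fin_two_add_add (x y : Fin 2) : x + y + y = x := by
  fin_cases x <;> fin_cases y <;> rfl

lemma flipQubit_involutive {Q : Type} [DecidableEq Q] (t : Q) (f : Bits Q → Fin 2)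
    (hf : ∀ b s, f (Function.update b t s) = f b) :
    Function.Involutive (flipQubit t f) := by
  intro b
  simp [flipQubit, hf, fin_two_add_add]

lemma cnotOp_eq_basisMap (c t : Q) : cnotOp c t = basisMap (flipQubit t fun b => b c) := rfl

lemma cnotOp_conjTranspose {c t : Q} (h : c ≠ t) : (cnotOp c t)ᴴ = cnotOp c t :=
  basisMap_conjTranspose_of_involutive (flipQubit_involutive t _ fun b s => by simp [h])

lemma Gate.conjTranspose_op_mul_op (g : Gate Q) : g.opᴴ * g.op = 1 := by
  cases g with
  | H q =>
    rw [Gate.op, onQubit_conjTranspose, onQubit_mul, hadamard_conjTranspose, hadamard_mul_self,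
      onQubit_one]
  | T q =>
    rw [Gate.op, onQubit_conjTranspose, onQubit_mul, tGate_conjTranspose_mul_self, onQubit_one]
  | CNOT c t h =>
    have hinv := flipQubit_involutive t (fun b => b c) fun b s => by simp [h]
    rw [Gate.op, cnotOp_conjTranspose h, cnotOp_eq_basisMap, basisMap_mul_basisMap,
      hinv.comp_self, basisMap_id]

lemma Gate.conjTranspose_op_mem (g : Gate Q) : g.opᴴ ∈ circuitOps Q := by
  cases g with
  | H q =>
    rw [Gate.op, onQubit_conjTranspose, hadamard_conjTranspose]
    exact (Gate.H q).op_mem_circuitOps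
  | T q =>
    rw [Gate.op, onQubit_conjTranspose, tGate_conjTranspose, ← onQubit_pow]
    exact pow_mem (Gate.T q).op_mem_circuitOps 7
  | CNOT c t h =>
    rw [Gate.op, cnotOp_conjTranspose h]
    exact (Gate.CNOT c t h).op_mem_circuitOps

lemma Gate.op_mem_cycLoc (g : Gate Q) (a b : Bits Q) : g.op a b ∈ cycLoc := by
  have ho : omega8 ∈ cycLoc := cycInt_le_cycLoc omega8_mem_cycInt
  have hs := inv_sqrt_two_mem_cycLoc
  cases g with
  | H q =>
    simp only [Gate.op, onQubit, hadamard_eq]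
    split_ifs
    · generalize a q = x, b q = y
      fin_cases x <;> fin_cases y <;> simpa using hs
    · exact zero_mem _
  | T q =>
    simp only [Gate.op, onQubit, tGate]
    split_ifs
    · generalize a q = x, b q = y
      fin_cases x <;> fin_cases y <;> simp [ho]
    · exact zero_mem _
  | CNOT c t h =>
    simp only [Gate.op, cnotOp]
    split_ifs
    · exact one_mem _
    · exact zero_mem _

lemma conjTranspose_mul_self_of_mem_circuitOps {U : QOp Q} (hU : U ∈ circuitOps Q) :
    Uᴴ * U = 1 := by
  obtain ⟨c, rfl⟩ := hU
  induction c with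
  | nil => simp [Circuit.op]
  | cons g c ih =>
    rw [Circuit.op, conjTranspose_mul, Matrix.mul_assoc, ← Matrix.mul_assoc _ᴴ (Circuit.op c), ih,
      Matrix.one_mul, g.conjTranspose_op_mul_op]

lemma conjTranspose_mem_circuitOps {U : QOp Q} (hU : U ∈ circuitOps Q) : Uᴴ ∈ circuitOps Q := by
  obtain ⟨c, rfl⟩ := hU
  induction c with
  | nil => simp [Circuit.op]
  | cons g c ih =>
    rw [Circuit.op, conjTranspose_mul]
    exact mul_mem g.conjTranspose_op_mem ih

lemma apply_mem_cycLoc_of_mem_circuitOps {U : QOp Q} (hU : U ∈ circuitOps Q) (a b : Bits Q) :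
    U a b ∈ cycLoc := by
  obtain ⟨c, rfl⟩ := hU
  induction c generalizing a b with
  | nil =>
    rw [Circuit.op, Matrix.one_apply]
    split_ifs
    · exact one_mem _
    · exact zero_mem _
  | cons g c ih =>
    rw [Circuit.op, Matrix.mul_apply]
    exact sum_mem fun x _ => mul_mem (ih a x) (g.op_mem_cycLoc x b)

/-! ### Diagonal operators and controlled flips -/

/-- The phase functions `d` for which the diagonal operator `d` is performed by a circuit. -/
def circuitPhases (Q : Type) [Fintype Q] [DecidableEq Q] : Submonoid (Bits Q → ℂ) where
  carrier := {d | diagonal d ∈ circuitOps Q}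
  one_mem' := by
    change diagonal (fun _ => (1 : ℂ)) ∈ circuitOps Q
    rw [diagonal_one]; exact one_mem _
  mul_mem' := by
    intro d e hd he
    change diagonal (fun b => d b * e b) ∈ circuitOps Q
    rw [← diagonal_mul_diagonal]
    exact mul_mem hd he

lemma star_mem_circuitPhases {d : Bits Q → ℂ} (hd : d ∈ circuitPhases Q) :
    star d ∈ circuitPhases Q := by
  have : (diagonal d)ᴴ ∈ circuitOps Q := conjTranspose_mem_circuitOps hd
  rwa [diagonal_conjTranspose] at this

lemma comp_mem_circuitPhases {d : Bits Q → ℂ} {σ : Bits Q → Bits Q}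
    (hσ : Function.Injective σ) (hσ' : basisMap σ ∈ circuitOps Q) (hd : d ∈ circuitPhases Q) :
    d ∘ σ ∈ circuitPhases Q := by
  have h := mul_mem (mul_mem (conjTranspose_mem_circuitOps hσ') hd) hσ'
  rw [conjTranspose_basisMap_mul, mul_basisMap, submatrix_submatrix, Function.id_comp,
    Function.comp_id, submatrix_diagonal _ _ hσ] at h
  exact h

lemma onQubit_tGate (q : Q) : onQubit tGate q = diagonal fun b => omega8 ^ (b q).val := by
  rw [diagonal_eq_controlled q, onQubit_eq_controlled, tGate_eq_diagonal]
  congr 1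
  ext a : 1
  congr 1
  ext s
  fin_cases s <;> simp

lemma omega8_pow_bit_mem (q : Q) : (fun b : Bits Q => omega8 ^ (b q).val) ∈ circuitPhases Q := by
  have := (Gate.T q).op_mem_circuitOps
  rw [Gate.op, onQubit_tGate] at this
  exact this

lemma omega8_pow_add_bit_mem {q r : Q} (h : q ≠ r) :
    (fun b : Bits Q => omega8 ^ (b q + b r).val) ∈ circuitPhases Q := by
  have h1 := comp_mem_circuitPhases
    (flipQubit_involutive q (fun b => b r) fun b s => by simp [h.symm]).injective
    (Gate.CNOT r q h.symm).op_mem_circuitOps (omega8_pow_bit_mem q)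
  convert h1 using 2 with b
  simp [flipQubit]

lemma omega8_pow_add_add_bit_mem {q r s : Q} (hqr : q ≠ r) (hqs : q ≠ s) :
    (fun b : Bits Q => omega8 ^ (b q + b r + b s).val) ∈ circuitPhases Q := by
  have h1 := comp_mem_circuitPhases
    (flipQubit_involutive q (fun b => b s) fun b x => by simp [hqs.symm]).injective
    (Gate.CNOT s q hqs.symm).op_mem_circuitOps (omega8_pow_add_bit_mem hqr)
  convert h1 using 2 with b
  simp [flipQubit, hqr.symm, add_right_comm]

/-- The controlled `S` gate. -/
lemma controlled_phase_mem {q r : Q} (h : q ≠ r) :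
    (fun b : Bits Q => if b q = 1 ∧ b r = 1 then Complex.I else 1) ∈ circuitPhases Q := by
  have h1 := mul_mem (mul_mem (omega8_pow_bit_mem q) (omega8_pow_bit_mem r))
    (star_mem_circuitPhases (omega8_pow_add_bit_mem h))
  convert h1 using 1
  ext b
  have h2 := star_omega8
  simp only [Pi.mul_apply, Pi.star_apply]
  generalize b q = x, b r = y
  have h0 := omega8_ne_zero
  have hsq := omega8_sq
  fin_cases x <;> fin_cases y <;> simp_all [← sq]

/-- The sign function of a set of control qubits: `-1` where all of them are set. -/
noncomputable def controlSign (S : Finset Q) (b : Bits Q) : ℂ := if ∀ q ∈ S, b q = 1 then -1 else 1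

/-- The doubly controlled `Z` gate, from the identity
`4xyz = x + y + z - (x ⊕ y) - (x ⊕ z) - (y ⊕ z) + (x ⊕ y ⊕ z)` for bits `x, y, z`. -/
lemma controlSign_three_mem {q r s : Q} (hqr : q ≠ r) (hqs : q ≠ s) (hrs : r ≠ s) :
    controlSign {q, r, s} ∈ circuitPhases Q := by
  have h1 := mul_mem (mul_mem (mul_mem (mul_mem (mul_mem (mul_mem (omega8_pow_bit_mem q)
    (omega8_pow_bit_mem r)) (omega8_pow_bit_mem s))
    (star_mem_circuitPhases (omega8_pow_add_bit_mem hqr)))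
    (star_mem_circuitPhases (omega8_pow_add_bit_mem hqs)))
    (star_mem_circuitPhases (omega8_pow_add_bit_mem hrs)))
    (omega8_pow_add_add_bit_mem hqr hqs)
  convert h1 using 1
  ext b
  have h2 := star_omega8
  have h0 := omega8_ne_zero
  have h4 := omega8_pow_four
  simp only [Pi.mul_apply, Pi.star_apply, controlSign, Finset.mem_insert, Finset.mem_singleton,
    forall_eq_or_imp, forall_eq]
  generalize b q = x, b r = y, b s = z
  fin_cases x <;> fin_cases y <;> fin_cases z <;> simp_all
  rw [← h4]; ring

lemma controlSign_one_mem (q : Q) : controlSign {q} ∈ circuitPhases Q := by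
  have h1 := pow_mem (omega8_pow_bit_mem q) 4
  convert h1 using 1
  ext b
  have h4 := omega8_pow_four
  simp only [Pi.pow_apply, controlSign, Finset.mem_singleton, forall_eq]
  generalize b q = x
  fin_cases x <;> simp_all

lemma controlSign_two_mem {q r : Q} (h : q ≠ r) : controlSign {q, r} ∈ circuitPhases Q := by
  have h1 := pow_mem (controlled_phase_mem h) 2
  convert h1 using 1
  ext b
  simp only [Pi.pow_apply, controlSign, Finset.mem_insert, Finset.mem_singleton,
    forall_eq_or_imp, forall_eq]
  split_ifs <;> simp

/-- The conjunction of the qubits in `S`. -/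
def conjunction (S : Finset Q) (b : Bits Q) : Fin 2 := if ∀ q ∈ S, b q = 1 then 1 else 0

lemma conjunction_update {S : Finset Q} {t : Q} (ht : t ∉ S) (b : Bits Q) (s : Fin 2) :
    conjunction S (Function.update b t s) = conjunction S b := by
  unfold conjunction
  refine if_congr (forall_congr' fun q => forall_congr' fun hq => ?_) rfl rfl
  have : q ≠ t := fun h => ht (h ▸ hq)
  simp [this]

/-- Conjugation by a Hadamard gate: a multiply controlled `Z` gate gives a multiply controlled
`X` gate. -/
lemma basisMap_flipQubit_mem {S : Finset Q} {t : Q} (ht : t ∉ S)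
    (h : controlSign (insert t S) ∈ circuitPhases Q) :
    basisMap (flipQubit t (conjunction S)) ∈ circuitOps Q := by
  have hH := (Gate.H t).op_mem_circuitOps
  have h1 := mul_mem (mul_mem hH h) hH
  convert h1 using 1
  rw [Gate.op, onQubit_eq_controlled, diagonal_eq_controlled t,
    controlled_mul t _ _ (by simp), controlled_mul t _ _ (by simp)]
  have hsq : ((Real.sqrt 2 : ℝ) : ℂ)⁻¹ * ((Real.sqrt 2 : ℝ) : ℂ)⁻¹ = 1 / 2 := by
    rw [← mul_inv, ← sq, sqrt_two_sq, one_div]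
  ext a b
  have hsign : ∀ s : Fin 2, controlSign (insert t S) (Function.update a t s) =
      if s = 1 ∧ conjunction S a = 1 then -1 else 1 := by
    intro s
    unfold controlSign
    rw [← conjunction_update ht a s]
    simp [conjunction]
  have hmat : hadamard * (diagonal fun s => controlSign (insert t S) (Function.update a t s)) *
      hadamard = fun x y => if x = y + conjunction S a then 1 else 0 := by
    simp only [hsign, hadamard_eq]
    generalize conjunction S a = z
    ext x y
    simp only [Matrix.mul_apply, Fin.sum_univ_two, diagonal_apply]
    fin_cases x <;> fin_cases y <;> fin_cases z <;> simp [hsq] <;> norm_num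
  simp only [controlled, hmat, basisMap]
  by_cases hab : ∀ r, r ≠ t → a r = b r
  · rw [if_pos hab]
    have hc : conjunction S a = conjunction S b := by
      unfold conjunction
      refine if_congr (forall_congr' fun q => forall_congr' fun hq => ?_) rfl rfl
      rw [hab q fun h => ht (h ▸ hq)]
    rw [hc]
    refine if_congr ⟨fun h => ?_, fun h => ?_⟩ rfl rfl
    · rw [h]; simp [flipQubit]
    · ext r
      by_cases hr : r = t
      · subst hr; simp [flipQubit, h]
      · simp [flipQubit, hr, hab r hr]
  · rw [if_neg hab, if_neg]
    rintro rfl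
    exact hab fun r hr => by simp [flipQubit, hr]

/-- All multiply controlled `Z` gates that leave one qubit idle. Given a `Z` gate controlled by
`S ∪ {t}`, the commutator of the corresponding flip of `t` with the `Z` gate on `{t, u, v}` is the
`Z` gate on `S ∪ {u, v}`. -/
lemma controlSign_mem (n : ℕ) : ∀ S : Finset Q, S.card = n + 1 → n + 1 < Fintype.card Q →
    controlSign S ∈ circuitPhases Q := by
  induction n using Nat.strong_induction_on with
  | _ n ih =>
  intro S hS hn
  rcases Nat.lt_or_ge n 2 with h2 | h2
  · interval_cases n
    · obtain ⟨q, rfl⟩ := Finset.card_eq_one.mp hS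
      exact controlSign_one_mem q
    · obtain ⟨q, r, h, rfl⟩ := Finset.card_eq_two.mp hS
      exact controlSign_two_mem h
  · obtain ⟨t, ht⟩ : ∃ t, t ∉ S := by
      by_contra! hcon
      rw [Finset.eq_univ_iff_forall.mpr hcon, Finset.card_univ] at hS
      omega
    obtain ⟨u, hu, v, hv, huv⟩ := Finset.one_lt_card.mp (by omega : 1 < S.card)
    have htu : t ≠ u := fun h => ht (h ▸ hu)
    have htv : t ≠ v := fun h => ht (h ▸ hv)
    set S' := (S.erase u).erase v with hS'
    have hcard : S'.card = n - 1 := by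
      rw [hS', Finset.card_erase_of_mem (by simp [hv, huv.symm]), Finset.card_erase_of_mem hu, hS]
      omega
    have htS' : t ∉ S' := fun h => ht (Finset.mem_of_mem_erase (Finset.mem_of_mem_erase h))
    have h1 := ih (n - 1) (by omega) (insert t S')
      (by rw [Finset.card_insert_of_notMem htS', hcard]) (by omega)
    have h3 := controlSign_three_mem htu htv huv
    have h4 := mul_mem h3 (comp_mem_circuitPhases
      (flipQubit_involutive t (conjunction S') (conjunction_update htS')).injective
      (basisMap_flipQubit_mem htS' h1) h3)
    convert h4 using 1
    ext b
    have hSall : (∀ q ∈ S, b q = 1) ↔ conjunction S' b = 1 ∧ b u = 1 ∧ b v = 1 := by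
      unfold conjunction
      constructor
      · intro h
        exact ⟨if_pos fun q hq => h q (Finset.mem_of_mem_erase (Finset.mem_of_mem_erase hq)),
          h u hu, h v hv⟩
      · rintro ⟨h, hbu, hbv⟩ q hq
        by_cases hqu : q = u
        · rwa [hqu]
        · by_cases hqv : q = v
          · rwa [hqv]
          · have h' : ∀ q ∈ S', b q = 1 := by
              by_contra hcon
              simp [hcon] at h
            exact h' q (by simp [hS', hq, hqu, hqv])
    simp only [Pi.mul_apply, Function.comp_apply, controlSign, hSall, flipQubit, Finset.mem_insert,
      Finset.mem_singleton, forall_eq_or_imp, forall_eq, Function.update_self,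
      Function.update_of_ne htu.symm, Function.update_of_ne htv.symm]
    generalize b t = x, b u = y, b v = z, conjunction S' b = w
    fin_cases x <;> fin_cases y <;> fin_cases z <;> fin_cases w <;> simp

/-! ### Circuits for two-level operators -/

lemma basisMap_translation_mem (v : Bits Q) :
    basisMap (fun b : Bits Q => b + v) ∈ circuitOps Q := by
  let T : AddSubmonoid (Bits Q) :=
    { carrier := {v | basisMap (fun b : Bits Q => b + v) ∈ circuitOps Q}
      zero_mem' := by
        change basisMap (fun b : Bits Q => b + 0) ∈ circuitOps Q
        simp only [add_zero]
        exact basisMap_id (Q := Q) ▸ one_mem _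
      add_mem' := by
        intro v w hv hw
        have : basisMap (fun b : Bits Q => b + w) * basisMap (fun b : Bits Q => b + v) ∈
            circuitOps Q := mul_mem hw hv
        have e : (fun b : Bits Q => b + w) ∘ (fun b => b + v) = fun b => b + (v + w) :=
          funext fun b => add_assoc b v w
        rwa [basisMap_mul_basisMap, e] at this }
  change v ∈ T
  rw [← Finset.univ_sum_single v]
  refine sum_mem fun q _ => ?_
  generalize v q = x
  fin_cases x
  · simp
  · have h := basisMap_flipQubit_mem (Finset.notMem_empty q) (by simpa using controlSign_one_mem q)
    change basisMap _ ∈ circuitOps Q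
    convert h using 2
    ext b r : 2
    by_cases hr : r = q
    · subst hr; simp [flipQubit, conjunction]
    · simp [flipQubit, hr]

/-- The phases `i` and `-i` on the two ends of an edge of the hypercube of basis states. The
commutator of a controlled `S` gate on `r`, `t` with the flip of `t` controlled by all qubits
but `r` and `t` has these phases on the edge at the all-ones state. -/
lemma edge_phase_mem (hQ : 3 ≤ Fintype.card Q) (e : Bits Q) (t : Q) :
    (fun b : Bits Q => if ∀ r, r ≠ t → b r = e r then (if b t = 1 then -Complex.I else Complex.I)
      else 1) ∈ circuitPhases Q := by
  obtain ⟨r, hr⟩ : ∃ r, r ≠ t := by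
    have : Nontrivial Q := Fintype.one_lt_card_iff_nontrivial.mp (by omega)
    exact exists_ne t
  set S := (Finset.univ.erase r).erase t with hS
  have htS : t ∉ S := Finset.notMem_erase t _
  have hins : insert t S = Finset.univ.erase r := Finset.insert_erase (by simp [hr.symm])
  have hcard : (Finset.univ.erase r : Finset Q).card = Fintype.card Q - 2 + 1 := by
    rw [Finset.card_erase_of_mem (Finset.mem_univ r), Finset.card_univ]; omega
  have h1 := basisMap_flipQubit_mem htS (hins ▸ controlSign_mem _ _ hcard (by omega))
  have h2 := controlled_phase_mem hr
  have h3 := mul_mem (star_mem_circuitPhases h2) (comp_mem_circuitPhases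
    (flipQubit_involutive t (conjunction S) (conjunction_update htS)).injective h1 h2)
  -- translate the edge at the all-ones state to the given one
  obtain ⟨v, hvt, hv⟩ : ∃ v : Bits Q, v t = 0 ∧ ∀ q, q ≠ t → v q = e q + 1 :=
    ⟨Function.update (e + 1) t 0, by simp, fun q hq => by simp [hq]⟩
  have h4 := comp_mem_circuitPhases (add_left_injective v) (basisMap_translation_mem v) h3
  convert h4 using 1
  ext b
  have hx : ∀ x y : Fin 2, x + (y + 1) = 1 ↔ x = y := by decide
  have hall : (∀ q, q ≠ t → b q = e q) ↔ conjunction S (b + v) = 1 ∧ b r = e r := by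
    unfold conjunction
    constructor
    · intro h
      refine ⟨if_pos fun q hq => ?_, h r hr⟩
      have hqt : q ≠ t := fun h => htS (h ▸ hq)
      rw [Pi.add_apply, hv q hqt, hx, h q hqt]
    · rintro ⟨h, hbr⟩ q hqt
      by_cases hqr : q = r
      · rwa [hqr]
      · have h' : ∀ q ∈ S, (b + v) q = 1 := by
          by_contra hcon
          rw [if_neg hcon] at h
          exact zero_ne_one h
        have := h' q (by simp [hS, hqt, hqr])
        rwa [Pi.add_apply, hv q hqt, hx] at this
  have hbr : (b + v) r = 1 ↔ b r = e r := by rw [Pi.add_apply, hv r hr, hx]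
  have hbt : (b + v) t = b t := by rw [Pi.add_apply, hvt, add_zero]
  simp only [Pi.mul_apply, Pi.star_apply, Function.comp_apply, hall, flipQubit,
    Function.update_self, Function.update_of_ne hr, hbr, hbt]
  generalize conjunction S _ = z, b t = x
  by_cases hbe : b r = e r
  · fin_cases x <;> fin_cases z <;> simp [hbe]
  · simp [hbe]

lemma hadamard_mul_tGate_mul_hadamard : hadamard * tGate * hadamard =
    (1 / 2 : ℂ) • !![1 + omega8, 1 - omega8; 1 - omega8, 1 + omega8] := by
  have h : ((Real.sqrt 2 : ℝ) : ℂ)⁻¹ * ((Real.sqrt 2 : ℝ) : ℂ)⁻¹ = 1 / 2 := by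
    rw [← mul_inv, ← sq, sqrt_two_sq, one_div]
  rw [hadamard_eq, smul_mul_assoc, smul_mul_smul_comm, h, tGate]
  ext i j
  fin_cases i <;> fin_cases j <;> simp [sub_eq_add_neg]

/-- A phased Hadamard gate is conjugate to `diag(i, -i)` under the Clifford+T group. -/
lemma phasedHadamard_eq_conj (k : ℕ) :
    tGate ^ k * (hadamard * tGate * hadamard) * diagonal ![Complex.I, -Complex.I] *
      (tGate ^ k * (hadamard * tGate * hadamard))ᴴ = phasedHadamard (k + 6) := by
  set u : ℂ := ((Real.sqrt 2 : ℝ) : ℂ)⁻¹ with hu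
  have hs : ((Real.sqrt 2 : ℝ) : ℂ) = 2 * u := by
    rw [hu, ← sqrt_two_sq, sq, mul_inv_cancel_right₀ sqrt_two_ne_zero]
  have hω : omega8 = u * (1 + Complex.I) := by
    rw [omega8_eq]; push_cast; rw [hs]; ring
  have hω' : (starRingEnd ℂ) omega8 = u * (1 - Complex.I) := by
    rw [omega8_eq]
    simp only [map_add, map_mul, Complex.conj_ofReal, Complex.conj_I]
    push_cast; rw [hs]; ring
  have hk : (starRingEnd ℂ) (omega8 ^ k) = (omega8 ^ k)⁻¹ := star_omega8_pow k
  have h0 : omega8 ^ k ≠ 0 := pow_ne_zero _ omega8_ne_zero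
  have h6 : omega8 ^ (k + 6) = -Complex.I * omega8 ^ k := by
    rw [pow_add, show omega8 ^ 6 = omega8 ^ 4 * omega8 ^ 2 by ring, omega8_pow_four, omega8_sq]
    ring
  have h6' : (omega8 ^ (k + 6))⁻¹ = Complex.I * (omega8 ^ k)⁻¹ := by
    rw [h6, mul_inv, inv_neg, Complex.inv_I, neg_neg]
  rw [hadamard_mul_tGate_mul_hadamard, tGate_pow, phasedHadamard, h6', h6,
    show Complex.I / ((Real.sqrt 2 : ℝ) : ℂ) = Complex.I * u from div_eq_mul_inv _ _]
  clear_value u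
  generalize omega8 ^ k = c at *
  ext i j
  fin_cases i <;> fin_cases j <;>
    simp [Matrix.mul_apply, Fin.sum_univ_two, conjTranspose_apply, diagonal_apply, hk, hω',
      Complex.conj_ofNat]
  all_goals rw [hω]
  · ring
  · ring
  · ring
  · field_simp
    ring

lemma twoLevel_update_eq_controlled (e : Bits Q) (t : Q) (M : Matrix (Fin 2) (Fin 2) ℂ) :
    twoLevel (Function.update e t 0) (Function.update e t 1) M =
      controlled t fun b => if ∀ r, r ≠ t → b r = e r then M else 1 := by
  have hupd : ∀ (b : Bits Q) (s : Fin 2), b = Function.update e t s ↔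
      (∀ r, r ≠ t → b r = e r) ∧ b t = s := by
    intro b s
    constructor
    · rintro rfl
      exact ⟨fun r hr => by simp [hr], by simp⟩
    · rintro ⟨h, rfl⟩
      ext r : 1
      by_cases hr : r = t
      · subst hr; simp
      · simp [hr, h r hr]
  ext a b
  simp only [twoLevel, controlled, hupd]
  have hba : b = a ↔ (∀ r, r ≠ t → a r = b r) ∧ b t = a t := by
    constructor
    · rintro rfl; simp
    · rintro ⟨h, ht⟩
      ext r : 1
      by_cases hr : r = t
      · rw [hr, ht]
      · exact (h r hr).symm
  by_cases ha : ∀ r, r ≠ t → a r = e r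
  · have hab : (∀ r, r ≠ t → a r = b r) ↔ ∀ r, r ≠ t → b r = e r :=
      ⟨fun h r hr => (h r hr).symm.trans (ha r hr), fun h r hr => (ha r hr).trans (h r hr).symm⟩
    have haT := eq_true ha
    simp only [hab, haT, true_and, if_true]
    by_cases hb : ∀ r, r ≠ t → b r = e r
    · have hbT := eq_true hb
      simp only [hbT, true_and, if_true]
      generalize a t = x, b t = y
      fin_cases x <;> fin_cases y <;> simp
    · have hbF := eq_false hb
      have hneq : b ≠ a := fun h => hb (h ▸ ha)
      simp only [hbF, false_and, if_false]
      generalize a t = x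
      fin_cases x <;> simp
  · have haF := eq_false ha
    simp only [haF, false_and, if_false, hba, Matrix.one_apply, eq_comm (a := b t), ite_and]

lemma twoLevel_edge_mem (hQ : 3 ≤ Fintype.card Q) (e : Bits Q) (t : Q) (m : ℕ) :
    twoLevel (Function.update e t 0) (Function.update e t 1) (phasedHadamard m) ∈ circuitOps Q := by
  have hper : phasedHadamard m = phasedHadamard (m + 2 + 6) := by
    rw [phasedHadamard, phasedHadamard, add_assoc, pow_add, omega8_pow_eight, mul_one]
  have hagree : ∀ (a : Bits Q) (s : Fin 2), (∀ r, r ≠ t → Function.update a t s r = e r) ↔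
      ∀ r, r ≠ t → a r = e r := fun a s =>
    forall_congr' fun r => forall_congr' fun hr => by rw [Function.update_of_ne hr]
  have hT := (Gate.T t).op_mem_circuitOps
  have hH := (Gate.H t).op_mem_circuitOps
  have hM := mul_mem (pow_mem hT (m + 2)) (mul_mem (mul_mem hH hT) hH)
  simp only [Gate.op, onQubit_mul, onQubit_pow] at hM
  have h := mul_mem (mul_mem hM (edge_phase_mem hQ e t)) (conjTranspose_mem_circuitOps hM)
  rw [onQubit_conjTranspose, onQubit_eq_controlled, onQubit_eq_controlled,
    diagonal_eq_controlled t, controlled_mul t _ _ (by simp), controlled_mul t _ _ (by simp)] at h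
  convert h using 1
  rw [twoLevel_update_eq_controlled, hper, ← phasedHadamard_eq_conj]
  congr 1
  ext a : 1
  simp only [hagree, Function.update_self]
  split_ifs with ha
  · congr 3
    ext s
    fin_cases s <;> simp
  · have hHu : hadamard ∈ unitaryGroup (Fin 2) ℂ := mem_unitaryGroup_iff'.mpr
      (by rw [star_eq_conjTranspose, hadamard_conjTranspose, hadamard_mul_self])
    have hTu : tGate ∈ unitaryGroup (Fin 2) ℂ := mem_unitaryGroup_iff'.mpr
      (by rw [star_eq_conjTranspose, tGate_conjTranspose_mul_self])
    have hMu := mem_unitaryGroup_iff.mp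
      (mul_mem (pow_mem hTu (m + 2)) (mul_mem (mul_mem hHu hTu) hHu))
    rw [diagonal_one, Matrix.mul_one, ← star_eq_conjTranspose, hMu]

/-- Phased Hadamard gates on any two basis states: edges of the hypercube are composed to paths. -/
lemma twoLevel_phasedHadamard_mem (hQ : 3 ≤ Fintype.card Q) (n : ℕ) : ∀ x y : Bits Q,
    (Finset.univ.filter fun q => x q ≠ y q).card = n + 1 → ∀ m,
    twoLevel x y (phasedHadamard m) ∈ circuitOps Q := by
  have hedge : ∀ (x : Bits Q) (t : Q) (s : Fin 2), x t ≠ s → ∀ m,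
      twoLevel x (Function.update x t s) (phasedHadamard m) ∈ circuitOps Q := by
    intro x t s hs m
    have hne : Function.update x t 0 ≠ Function.update x t 1 := fun h => by
      have := congrFun h t
      simp at this
    have hx : x = Function.update x t (x t) := by simp
    have h01 : ∀ w : Fin 2, w = 0 ∨ w = 1 := by decide
    generalize x t = w at hs hx
    rcases h01 w with rfl | rfl <;> rcases h01 s with rfl | rfl
    · exact absurd rfl hs
    · have := twoLevel_edge_mem hQ x t m
      rwa [← hx] at this
    · have h := conjTranspose_mem_circuitOps (twoLevel_edge_mem hQ x t (7 * m + 4))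
      rw [twoLevel_conjTranspose hne, ← phasedHadamard_conjTranspose_swap, ← twoLevel_swap hne] at h
      rwa [← hx] at h
    · exact absurd rfl hs
  induction n with
  | zero =>
    intro x y h m
    obtain ⟨t, ht⟩ := Finset.card_eq_one.mp h
    have hmem : ∀ q, x q ≠ y q ↔ q = t := fun q => by
      have := Finset.ext_iff.mp ht q
      simpa using this
    have hy : y = Function.update x t (y t) := by
      ext q : 1
      by_cases hq : q = t
      · subst hq; simp
      · rw [Function.update_of_ne hq]
        exact (not_not.mp (mt (hmem q).mp hq)).symm
    rw [hy]
    exact hedge x t _ ((hmem t).mpr rfl) m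
  | succ n ih =>
    intro x y h m
    obtain ⟨t, ht⟩ : (Finset.univ.filter fun q => x q ≠ y q).Nonempty :=
      Finset.card_pos.mp (by omega)
    have htxy : x t ≠ y t := by simpa using ht
    set z := Function.update x t (y t) with hz
    have hzy : (Finset.univ.filter fun q => z q ≠ y q) =
        (Finset.univ.filter fun q => x q ≠ y q).erase t := by
      ext q
      by_cases hq : q = t
      · subst hq; simp [hz]
      · simp [hz, hq]
    have hcard : (Finset.univ.filter fun q => z q ≠ y q).card = n + 1 := by
      rw [hzy, Finset.card_erase_of_mem ht, h]; rfl
    have hxz : x ≠ z := fun h => htxy (by rw [h, hz]; simp)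
    have hzy' : z ≠ y := by
      rintro e
      simp [e] at hcard
    have hxy : x ≠ y := fun e => htxy (by rw [e])
    have h1 := ih z y hcard
    have h2 := hedge x t (y t) htxy m
    -- the rotation that carries `z` to `y`
    have hrot := mul_mem (h1 (0 + 4)) (h1 0)
    rw [twoLevel_mul hzy', phasedHadamard_mul] at hrot
    have h3 := mul_mem (mul_mem hrot h2) (conjTranspose_mem_circuitOps hrot)
    rw [twoLevel_conjTranspose hzy'] at h3
    have e1 : !![0, -(omega8 ^ 0)⁻¹; omega8 ^ 0, 0] =
        (!![0, -1; 1, 0] : Matrix (Fin 2) (Fin 2) ℂ) := by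
      simp
    have e2 : (!![0, -1; 1, 0] : Matrix (Fin 2) (Fin 2) ℂ)ᴴ = !![0, 1; -1, 0] := by
      ext i j
      fin_cases i <;> fin_cases j <;> simp
    rwa [e1, e2, twoLevel_conj hxz hzy' hxy] at h3

lemma twoLevel_mem_circuitOps (hQ : 3 ≤ Fintype.card Q) (x y : Bits Q) (hxy : x ≠ y) (m : ℕ) :
    twoLevel x y (phasedHadamard m) ∈ circuitOps Q := by
  obtain ⟨t, ht⟩ := Function.ne_iff.mp hxy
  have hpos : 0 < (Finset.univ.filter fun q => x q ≠ y q).card :=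
    Finset.card_pos.mpr ⟨t, by simpa using ht⟩
  obtain ⟨n, hn⟩ := Nat.exists_eq_succ_of_ne_zero hpos.ne'
  exact twoLevel_phasedHadamard_mem hQ n x y hn m

end CircuitGroup

/-! ### Exact synthesis of isometries -/

section Isometry

variable {Q : Type} [Fintype Q] [DecidableEq Q]

/-- An isometry over `ℤ[ω, 1/2]` with fewer columns than rows is part of the operator of a
Clifford+T circuit without ancillas. -/
lemma exists_circuit_of_isometry (hQ : 3 ≤ Fintype.card Q) {κ : Type*} [Fintype κ]
    [DecidableEq κ] (f : κ → Bits Q) (hf : Function.Injective f)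
    (hcard : Fintype.card κ < Fintype.card (Bits Q)) (K : Matrix (Bits Q) κ ℂ) (hK : Kᴴ * K = 1)
    (hKloc : ∀ a b, K a b ∈ cycLoc) :
    ∃ c : Circuit Q, ∀ a b, Circuit.op c a (f b) = K a b := by
  obtain ⟨g, hg, e⟩ := exists_mul_eq_partial_one (circuitOps Q)
    (fun _ => conjTranspose_mul_self_of_mem_circuitOps)
    (fun _ => apply_mem_cycLoc_of_mem_circuitOps)
    (twoLevel_mem_circuitOps hQ) f hf hcard K hK hKloc
  obtain ⟨c, hc⟩ := conjTranspose_mem_circuitOps hg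
  refine ⟨c, fun a b => ?_⟩
  have hK' : K = gᴴ * (g * K) := by
    rw [← Matrix.mul_assoc, conjTranspose_mul_self_of_mem_circuitOps hg, Matrix.one_mul]
  rw [hc, hK', e]
  simp [Matrix.mul_apply]

end Isometry

/-! ### Denominators in `ℚ(ω)` -/

section Denominators

lemma isIntegral_omega8 : IsIntegral ℚ omega8 :=
  IsIntegral.of_pow (n := 8) (by norm_num) (omega8_pow_eight ▸ isIntegral_one)

lemma exists_denominator {x : ℂ} (hx : x ∈ IntermediateField.adjoin ℚ ({omega8} : Set ℂ)) :
    ∃ d : ℕ, 0 < d ∧ (d : ℂ) * x ∈ cycInt := by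
  have hx' : x ∈ Algebra.adjoin ℚ ({omega8} : Set ℂ) := by
    rw [← IntermediateField.adjoin_simple_toSubalgebra_of_isAlgebraic isIntegral_omega8.isAlgebraic]
    exact hx
  clear hx
  induction hx' using Algebra.adjoin_induction with
  | mem x h =>
    rw [Set.mem_singleton_iff.mp h]
    exact ⟨1, one_pos, by simpa using omega8_mem_cycInt⟩
  | algebraMap r =>
    refine ⟨r.den, r.den_pos, ?_⟩
    have : ((r.den : ℕ) : ℂ) * algebraMap ℚ ℂ r = (r.num : ℂ) := by
      rw [mul_comm]
      have := Rat.mul_den_eq_num r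
      simp only [eq_ratCast]
      exact_mod_cast this
    rw [this]
    exact intCast_mem _ _
  | add x y _ _ hx hy =>
    obtain ⟨d, hd, hdx⟩ := hx
    obtain ⟨e, he, hey⟩ := hy
    refine ⟨d * e, Nat.mul_pos hd he, ?_⟩
    have : ((d * e : ℕ) : ℂ) * (x + y) = e * (d * x) + d * (e * y) := by push_cast; ring
    rw [this]
    exact add_mem (mul_mem (natCast_mem _ e) hdx) (mul_mem (natCast_mem _ d) hey)
  | mul x y _ _ hx hy =>
    obtain ⟨d, hd, hdx⟩ := hx
    obtain ⟨e, he, hey⟩ := hy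
    refine ⟨d * e, Nat.mul_pos hd he, ?_⟩
    have : ((d * e : ℕ) : ℂ) * (x * y) = d * x * (e * y) := by push_cast; ring
    rw [this]
    exact mul_mem hdx hey

lemma exists_common_denominator {α : Type*} [Fintype α] (v : α → ℂ)
    (hv : ∀ a, v a ∈ IntermediateField.adjoin ℚ ({omega8} : Set ℂ)) :
    ∃ d : ℕ, 0 < d ∧ ∀ a, (d : ℂ) * v a ∈ cycInt := by
  classical
  choose d hd hdv using fun a => exists_denominator (hv a)
  refine ⟨∏ a, d a, Finset.prod_pos fun a _ => hd a, fun a => ?_⟩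
  rw [← Finset.prod_erase_mul _ _ (Finset.mem_univ a), Nat.cast_mul, mul_assoc]
  exact mul_mem (natCast_mem _ _) (hdv a)

end Denominators

/-! ### The repeat-until-success design -/

section RepeatUntilSuccess

lemma sum_bits_two {A : Type*} [AddCommMonoid A] (F : Bits (Fin 2) → A) :
    ∑ x, F x = F 0 + (F ![0, 1] + (F ![1, 0] + F ![1, 1])) := by
  have : (Finset.univ : Finset (Bits (Fin 2))) = {0, ![0, 1], ![1, 0], ![1, 1]} := by decide
  rw [this, Finset.sum_insert (by decide), Finset.sum_insert (by decide),
    Finset.sum_insert (by decide), Finset.sum_singleton]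

/-- The scalars performed on the target qubits upon failure: `α` and `β` for two of the three
failure outcomes, while the third one never occurs. The value at the success outcome `0` plays no
role. -/
noncomputable def failureScalar (α β : ℂ) (x : Bits (Fin 2)) : ℂ :=
  if x = ![0, 1] then α else if x = ![1, 0] then β else 0

end RepeatUntilSuccess

theorem mainTheorem4 (n : ℕ) (hn : 1 ≤ n) (V : Matrix (Fin n → Fin 2) (Fin n → Fin 2) ℂ)
    (hV : V ∈ Matrix.unitaryGroup (Fin n → Fin 2) ℂ)
    (hω : ∀ a b, V a b ∈ IntermediateField.adjoin ℚ ({omega8} : Set ℂ)) :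
    ∃ m : ℕ, m ≤ 2 ∧ ∃ R : RUSCircuit n m, R.Implements V := by
  obtain ⟨d, hd, hdV⟩ := exists_common_denominator
    (fun p : Bits (Fin n) × Bits (Fin n) => V p.1 p.2) fun p => hω p.1 p.2
  -- `4 ^ d - d ^ 2` as a sum of four squares gives the probabilities of two failures
  have hle : d ^ 2 ≤ 4 ^ d := by
    rw [show 4 = 2 ^ 2 by norm_num, ← pow_mul, mul_comm, pow_mul]
    exact Nat.pow_le_pow_left (Nat.lt_two_pow_self).le 2
  obtain ⟨a, b, c, e, habce⟩ := Nat.sum_four_squares (4 ^ d - d ^ 2)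
  have hsum : (d : ℂ) ^ 2 + (a ^ 2 + b ^ 2) + (c ^ 2 + e ^ 2) = (2 ^ d) ^ 2 := by
    have h : d ^ 2 + (a ^ 2 + b ^ 2) + (c ^ 2 + e ^ 2) = (2 ^ d) ^ 2 := by
      have h4 : (2 ^ d) ^ 2 = 4 ^ d := by rw [← pow_mul, mul_comm, pow_mul]; norm_num
      omega
    exact_mod_cast h
  set γ : Bits (Fin 2) → ℂ :=
    failureScalar ((a + b * Complex.I) / 2 ^ d) ((c + e * Complex.I) / 2 ^ d) with hγ
  set p : ℝ := (d / 2 ^ d) ^ 2 with hp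
  have hsqrtp : Real.sqrt p = d / 2 ^ d := Real.sqrt_sq (by positivity)
  -- the blocks of the design, one for each outcome
  let M : Bits (Fin 2) → QOp (Fin n) := fun x => if x = 0 then (Real.sqrt p : ℂ) • V else γ x • 1
  let K : Matrix (Bits (Fin n ⊕ Fin 2)) (Bits (Fin n)) ℂ :=
    Matrix.of fun r b => M (r ∘ Sum.inr) (r ∘ Sum.inl) b
  have hpow : ∀ z ∈ cycInt, z / 2 ^ d ∈ cycLoc := fun z hz => by
    rw [div_eq_mul_inv, ← inv_pow]
    exact mul_mem (cycInt_le_cycLoc hz) (pow_mem inv_two_mem_cycLoc d)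
  have hKloc : ∀ r i, K r i ∈ cycLoc := by
    intro r i
    simp only [K, M, Matrix.of_apply]
    split_ifs with h
    · have : ((Real.sqrt p : ℂ) • V) (r ∘ Sum.inl) i = d * V (r ∘ Sum.inl) i / 2 ^ d := by
        rw [hsqrtp, Matrix.smul_apply, smul_eq_mul]; push_cast; ring
      rw [this]
      exact hpow _ (hdV (r ∘ Sum.inl, i))
    · have hγloc : γ (r ∘ Sum.inr) ∈ cycLoc := by
        rw [hγ, failureScalar]
        split_ifs
        · exact hpow _ (add_mem (natCast_mem _ a) (mul_mem (natCast_mem _ b) I_mem_cycInt))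
        · exact hpow _ (add_mem (natCast_mem _ c) (mul_mem (natCast_mem _ e) I_mem_cycInt))
        · exact zero_mem _
      rw [Matrix.smul_apply, smul_eq_mul, Matrix.one_apply]
      split_ifs
      · simpa using hγloc
      · simp
  have hVV : Vᴴ * V = 1 := by
    rw [← star_eq_conjTranspose]; exact mem_unitaryGroup_iff'.mp hV
  have hscalar : ∀ z : ℂ, (z • (1 : QOp (Fin n)))ᴴ * (z • 1) = (star z * z) • 1 := fun z => by
    rw [conjTranspose_smul, conjTranspose_one, smul_mul_smul_comm, Matrix.one_mul]
  have hnormSq : ∀ x y : ℕ, star (((x : ℂ) + y * Complex.I) / 2 ^ d) *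
      ((x + y * Complex.I) / 2 ^ d) = (x ^ 2 + y ^ 2) / (2 ^ d) ^ 2 := fun x y => by
    have : star (((x : ℂ) + y * Complex.I) / 2 ^ d) = (x - y * Complex.I) / 2 ^ d := by
      simp [sub_eq_add_neg]
    rw [this, div_mul_div_comm, ← sq]
    congr 1
    linear_combination (-(y : ℂ) ^ 2) * Complex.I_sq
  have hblock : ∑ x, (M x)ᴴ * M x = 1 := by
    have h0 : (M 0)ᴴ * M 0 = ((d : ℂ) ^ 2 / (2 ^ d) ^ 2) • 1 := by
      simp only [M, if_true]
      rw [conjTranspose_smul, smul_mul_smul_comm, hVV, hsqrtp]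
      congr 1
      simp
      ring
    have h1 : M ![0, 1] = ((a + b * Complex.I) / 2 ^ d) • 1 := by
      simp [M, hγ, failureScalar]
    have h2 : M ![1, 0] = ((c + e * Complex.I) / 2 ^ d) • 1 := by
      simp [M, hγ, failureScalar]
    have h3 : M ![1, 1] = 0 := by
      simp [M, hγ, failureScalar]
    rw [sum_bits_two, h0, h1, h2, h3, hscalar, hscalar, hnormSq, hnormSq, Matrix.mul_zero, add_zero,
      ← add_smul, ← add_smul, ← add_div, ← add_div, ← add_assoc, hsum,
      div_self (pow_ne_zero _ (pow_ne_zero _ two_ne_zero)), one_smul]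
  have hK : Kᴴ * K = 1 := by
    rw [← hblock]
    ext i j
    rw [Matrix.mul_apply, Matrix.sum_apply,
      ← (Equiv.sumArrowEquivProdArrow (Fin n) (Fin 2) (Fin 2)).symm.sum_comp,
      Fintype.sum_prod_type_right]
    refine Finset.sum_congr rfl fun x _ => ?_
    rw [Matrix.mul_apply]
    rfl
  obtain ⟨U, hU⟩ := exists_circuit_of_isometry (Q := Fin n ⊕ Fin 2)
    (by simp; omega) (fun b : Bits (Fin n) => (Sum.elim b fun _ => 0 : Bits (Fin n ⊕ Fin 2)))
    (fun b b' h => funext fun q => congrFun h (Sum.inl q))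
    (by
      simp only [Bits, Fintype.card_fun, Fintype.card_fin, Fintype.card_sum]
      exact Nat.pow_lt_pow_right (by norm_num) (by omega)) K hK hKloc
  refine ⟨2, le_rfl, ⟨U, 0, fun _ => []⟩, ⟨p, by positivity, ?_⟩, fun x hx => ?_⟩
  · ext i j
    rw [RUSCircuit.outcomeOp, hU]
    simp [K, M, Sum.elim_comp_inr, Sum.elim_comp_inl]
  · have hout : RUSCircuit.outcomeOp ⟨U, 0, fun _ => []⟩ x = γ x • (1 : QOp (Fin n)) := by
      ext i j
      rw [RUSCircuit.outcomeOp, hU]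
      have hx0 : x ≠ 0 := hx
      simp [K, M, Sum.elim_comp_inr, Sum.elim_comp_inl, hx0]
    rw [hout]
    rcases eq_or_ne (γ x) 0 with h0 | h0
    · exact ⟨0, 1, 1, le_rfl, one_mem _, by simp, by simp [h0], by simp [Circuit.op]⟩
    · -- the unitary is the phase of the scalar, which the empty correction undoes
      have hn0 : (‖γ x‖ : ℂ) ≠ 0 := by simpa using h0
      have hph : ‖γ x / ‖γ x‖‖ = 1 := by
        rw [norm_div, Complex.norm_real, norm_norm, div_self (norm_ne_zero_iff.mpr h0)]
      set ζ := γ x / ‖γ x‖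
      have hζ : ζ ≠ 0 := fun h => by simp [h] at hph
      refine ⟨‖γ x‖ ^ 2, ζ • 1, ζ, by positivity, ?_, hph, ?_, ?_⟩
      · rw [mem_unitaryGroup_iff', star_eq_conjTranspose, hscalar, ← starRingEnd_apply,
          ← Complex.inv_eq_conj hph, inv_mul_cancel₀ hζ, one_smul]
      · rw [Real.sqrt_sq (norm_nonneg _), smul_smul, mul_div_cancel₀ _ hn0]
      · have : (ζ • (1 : QOp (Fin n)))⁻¹ = ζ⁻¹ • 1 :=
          inv_eq_left_inv (by
            rw [smul_mul_smul_comm, inv_mul_cancel₀ hζ, one_smul, Matrix.one_mul])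
        rw [this, smul_smul, mul_inv_cancel₀ hζ, one_smul]
        rfl
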